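/- Let $n\ge 3$, let $\mathcal S^{n\times n}$ be the space of real symmetric $n\times n$ matrices, with norm $\|M\|=(\sum_{i,j}M_{ij}^2)^{1/2}$, and let $B_r\subset\mathbb R^n$ be the open ball of radius $r$ centred at the origin. For a positive $C^2$ function $u$ put $$A^u=-\frac{2}{n-2}u^{-\frac{n+2}{n-2}}\nabla^2u+\frac{2n}{(n-2)^2}u^{-\frac{2n}{n-2}}\nabla u\otimes\nabla u-\frac{2}{(n-2)^2}u^{-\frac{2n}{n-2}}|\nabla u|^2 I .$$ There is a constant $C(n)>0$, depending only on $n$, with the following property. Let $U\subset\mathcal S^{n\times n}$ be open, with $O^{-1}UO=U$ for all $O\in O(n)$, and such that $U\cap\{M+tN: 0<t<\infty\}$ is convex for all $M\in\mathcal S^{n\times n}$ and all positive definite $N\in\mathcal S^{n\times n}$. Let $F\in C^1(U)$ satisfy $F(O^{-1}MO)=F(M)$ for all $M\in U$, $O\in O(n)$, let the matrix $\left(\frac{\partial F}{\partial M_{ij}}(M)\right)$ be positive definite for all $M\in U$, and suppose that for some $\delta>0$, $F(M)\ne 1$ for all $M\in U$ with $\|M\|<\delta$. Let $R>0$ and let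 $u\in C^2(B_{3R})$ be a positive superharmonic function ($\Delta u\le 0$) satisfying $$F(A^u)=1,\qquad A^u\in U,\qquad\text{in } B_{3R}.$$ Then $$\Big(\sup_{B_R}u\Big)\Big(\inf_{B_{2R}}u\Big)\le C(n)\,\delta^{\frac{2-n}{2}}R^{2-n}.$$ -/

import Mathlib

open scoped Topology

/- The entrywise sup norm on matrices; it is used only to speak about open sets, `C^1` functions and
derivatives, none of which depend on the choice of a norm on a finite-dimensional space. -/
attribute [local instance] Matrix.normedAddCommGroup Matrix.normedSpace

/-- The space of real symmetric `n × n` matrices. -/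
def SymMat (n : ℕ) : Submodule ℝ (Matrix (Fin n) (Fin n) ℝ) where
  carrier := {M | M.IsSymm}
  add_mem' := fun ha hb => Matrix.IsSymm.add ha hb
  zero_mem' := Matrix.isSymm_zero
  smul_mem' := fun c _ hM => Matrix.IsSymm.smul hM c

/-- Conjugation of a symmetric matrix by an orthogonal matrix, `O⁻¹ M O`. -/
def SymMat.conj {n : ℕ} (O : Matrix.orthogonalGroup (Fin n) ℝ) (M : SymMat n) : SymMat n :=
  ⟨((O⁻¹ : Matrix.orthogonalGroup (Fin n) ℝ) : Matrix (Fin n) (Fin n) ℝ) * M.1 * O.1, by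
    have hM : M.1.transpose = M.1 := M.2
    change (_ : Matrix (Fin n) (Fin n) ℝ).transpose = _
    simp [Matrix.transpose_mul, hM, Matrix.mul_assoc, Matrix.star_eq_conjTranspose,
      Matrix.conjTranspose_eq_transpose_of_trivial]⟩

/-- The symmetric matrix `(E_ij + E_ji) / 2`. -/
noncomputable def SymMat.unit {n : ℕ} (i j : Fin n) : SymMat n :=
  ⟨(1 / 2 : ℝ) • (Matrix.single i j (1 : ℝ) + Matrix.single j i (1 : ℝ)), by
    change (_ : Matrix (Fin n) (Fin n) ℝ).transpose = _
    simp [Matrix.transpose_add, Matrix.transpose_single, add_comm]⟩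

/-- The matrix `F_ij = ∂F/∂M_ij` of a function of a symmetric matrix, that is, the symmetric matrix
with `dF(M)[N] = ∑ i j, F_ij N_ij` for all symmetric `N`. -/
noncomputable def SymMat.grad {n : ℕ} (F : SymMat n → ℝ) (M : SymMat n) :
    Matrix (Fin n) (Fin n) ℝ :=
  Matrix.of fun i j => fderiv ℝ F M (SymMat.unit i j)

/-- The norm `(∑ i j, M_ij ^ 2) ^ (1/2)` of a symmetric matrix. -/
noncomputable def SymMat.hsNorm {n : ℕ} (M : SymMat n) : ℝ :=
  Real.sqrt (∑ i, ∑ j, M.1 i j ^ 2)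

/-- The partial derivative `∂u/∂x_i`. -/
noncomputable def partialD {n : ℕ} (u : EuclideanSpace ℝ (Fin n) → ℝ)
    (x : EuclideanSpace ℝ (Fin n)) (i : Fin n) : ℝ :=
  fderiv ℝ u x (EuclideanSpace.single i 1)

/-- The second partial derivative `∂²u/∂x_i∂x_j`. -/
noncomputable def partialD2 {n : ℕ} (u : EuclideanSpace ℝ (Fin n) → ℝ)
    (x : EuclideanSpace ℝ (Fin n)) (i j : Fin n) : ℝ :=
  iteratedFDeriv ℝ 2 u x ![EuclideanSpace.single i 1, EuclideanSpace.single j 1]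

/-- The conformal Hessian
`A^u = -2/(n-2) u^{-(n+2)/(n-2)} ∇²u + 2n/(n-2)² u^{-2n/(n-2)} ∇u ⊗ ∇u
  - 2/(n-2)² u^{-2n/(n-2)} |∇u|² I`. -/
noncomputable def conformalHessian {n : ℕ} (u : EuclideanSpace ℝ (Fin n) → ℝ)
    (x : EuclideanSpace ℝ (Fin n)) : Matrix (Fin n) (Fin n) ℝ :=
  (-(2 / ((n : ℝ) - 2)) * u x ^ (-(((n : ℝ) + 2) / ((n : ℝ) - 2)))) •
      Matrix.of (fun i j => partialD2 u x i j)
    + (2 * (n : ℝ) / ((n : ℝ) - 2) ^ 2 * u x ^ (-(2 * (n : ℝ) / ((n : ℝ) - 2)))) •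
      Matrix.of (fun i j => partialD u x i * partialD u x j)
    - (2 / ((n : ℝ) - 2) ^ 2 * u x ^ (-(2 * (n : ℝ) / ((n : ℝ) - 2))) *
        ∑ k, partialD u x k ^ 2) • (1 : Matrix (Fin n) (Fin n) ℝ)

/-! Put ξ = u^(-2/(n-2)). Then A^u = ξ∇²ξ - (|∇ξ|²/2) I, which is `jetHessian`. Since the exponent
is negative, the theorem becomes a lower bound for ξ(x₀)·S/R², where x₀ ∈ B_R and S bounds ξ on
B_{2R}. If this quantity were too small, A^u would enter the ball of radius δ at some point, where F
≠ 1.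

Superharmonicity makes the trace of A^u nonnegative, so a one-sided bound A^u ≤ τI already makes A^u
small (`SymMat.hsNorm_le`). The gradient term of A^u has the good sign, so such a bound follows once
a paraboloid of small opening touches ξ from above. This needs a ball B_d(x₁), with d not too small,
on which ξ ≤ 2ξ(x₁). `exists_point_selection` supplies x₁ with the reverse control ξ ≥ ξ(x₁)/2
nearby, and moving spheres turn that into the upper control (`IsConformalSolution.le_two_mul`).

The Kelvin transform conjugates the conformal Hessian by a reflection, so it preserves solutions. At
the first sphere for which the transform no longer lies strictly above ξ outside it, the two graphs
touch, either outside the sphere or to first order on it. The Hopf lemma for two solutions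
(`IsConformalSolution.hopf`) excludes both.

The equation enters only through `EllipticLevelSet`: ordered elements of {F = 1} coincide, a local
quantitative form of this holds for rank-one perturbations, and the set is invariant under
reflections. Convexity of U along positive definite rays serves the first property, by allowing the
mean value theorem between ordered matrices. -/

open scoped RealInnerProductSpace
open Filter Metric

/-! ### First and second order conditions at one-sided minima. -/

section SecondOrder

variable {E : Type*} [NormedAddCommGroup E] [InnerProductSpace ℝ E]

/-- `f` has the gradient field `p` near `x`, and `p` has the derivative `T` at `x`. -/
def HasHessianAt (f : E → ℝ) (p : E → E) (T : E →L[ℝ] E) (x : E) : Prop :=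
  (∀ᶠ y in 𝓝 x, HasFDerivAt f (innerSL ℝ (p y)) y) ∧ HasFDerivAt p T x

namespace HasHessianAt

variable {f g : E → ℝ} {p q : E → E} {S T : E →L[ℝ] E} {x : E}

theorem sub (hf : HasHessianAt f p T x) (hg : HasHessianAt g q S x) :
    HasHessianAt (fun y => f y - g y) (fun y => p y - q y) (T - S) x := by
  refine ⟨?_, hf.2.sub hg.2⟩
  filter_upwards [hf.1, hg.1] with y hy hy'
  have := hy.sub hy'
  rw [← map_sub] at this
  exact this

theorem const_mul (hf : HasHessianAt f p T x) (c : ℝ) :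
    HasHessianAt (fun y => c * f y) (fun y => c • p y) (c • T) x := by
  refine ⟨?_, hf.2.const_smul c⟩
  filter_upwards [hf.1] with y hy
  have := hy.const_mul c
  rw [← map_smul] at this
  exact this

/-- One-sided first order condition. -/
theorem inner_nonneg (hf : HasHessianAt f p T x) {v : E}
    (hv : ∀ᶠ t : ℝ in 𝓝[>] 0, f x ≤ f (x + t • v)) : 0 ≤ ⟪p x, v⟫ := by
  have h1 : HasDerivAt (fun t : ℝ => f (x + t • v)) ⟪p x, v⟫ 0 := by
    have hl : HasDerivAt (fun t : ℝ => x + t • v) v 0 := by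
      simpa using ((hasDerivAt_id (0 : ℝ)).smul_const v).const_add x
    have := (hf.1.self_of_nhds : HasFDerivAt f _ x)
    have h2 : HasFDerivAt f (innerSL ℝ (p x)) (x + (0 : ℝ) • v) := by simpa using this
    simpa [Function.comp_def] using h2.comp_hasDerivAt (0 : ℝ) hl
  by_contra! hneg
  have := (h1.tendsto_slope_zero_right).eventually_lt_const hneg
  obtain ⟨t, ht, ht', htp⟩ := (this.and (hv.and self_mem_nhdsWithin)).exists
  have htp : (0 : ℝ) < t := htp
  simp only [zero_add, zero_smul, add_zero, smul_eq_mul] at ht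
  have : 0 ≤ t⁻¹ * (f (x + t • v) - f x) := by
    apply mul_nonneg (by positivity); linarith
  linarith

/-- One-sided second order condition. -/
theorem inner_apply_nonneg (hf : HasHessianAt f p T x) (hp : p x = 0) {v : E}
    (hv : ∀ᶠ t : ℝ in 𝓝[>] 0, f x ≤ f (x + t • v)) : 0 ≤ ⟪T v, v⟫ := by
  have hl : ∀ s : ℝ, HasDerivAt (fun t : ℝ => x + t • v) v s := fun s => by
    simpa using ((hasDerivAt_id s).smul_const v).const_add x
  have htend : Tendsto (fun t : ℝ => x + t • v) (𝓝 0) (𝓝 x) := by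
    simpa using (hl 0).continuousAt.tendsto
  have h1 : ∀ᶠ t : ℝ in 𝓝 0, HasDerivAt (fun t : ℝ => f (x + t • v)) ⟪p (x + t • v), v⟫ t := by
    filter_upwards [htend.eventually hf.1] with t ht
    simpa [Function.comp_def] using ht.comp_hasDerivAt t (hl t)
  have h2 : HasDerivAt (fun t : ℝ => ⟪p (x + t • v), v⟫) ⟪T v, v⟫ 0 := by
    have h3 : HasFDerivAt p T (x + (0 : ℝ) • v) := by simpa using hf.2
    have h4 : HasDerivAt (fun t : ℝ => p (x + t • v)) (T v) 0 := h3.comp_hasDerivAt (0 : ℝ) (hl 0)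
    simpa using h4.inner ℝ (hasDerivAt_const (0 : ℝ) v)
  -- A negative second derivative makes the first derivative negative just after 0, and the mean
  -- value theorem then makes f decrease. Only differentiability of p at x itself is needed.
  by_contra! hneg
  have h5 := (h2.tendsto_slope_zero_right).eventually_lt_const hneg
  have h6 : ∀ᶠ t : ℝ in 𝓝[>] 0, ⟪p (x + t • v), v⟫ < 0 := by
    filter_upwards [h5, self_mem_nhdsWithin] with t ht htp
    have htp : (0 : ℝ) < t := htp
    simp only [zero_add, zero_smul, add_zero, hp, inner_zero_left, sub_zero, smul_eq_mul] at ht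
    by_contra! hc
    have : 0 ≤ t⁻¹ * ⟪p (x + t • v), v⟫ := mul_nonneg (by positivity) hc
    linarith
  obtain ⟨r, hr, hr1⟩ := Metric.eventually_nhds_iff.1 h1
  obtain ⟨r', hr', hr2⟩ := (mem_nhdsGT_iff_exists_Ioo_subset.1 h6)
  have hr' : (0 : ℝ) < r' := hr'
  have hmem : ∀ᶠ t : ℝ in 𝓝[>] 0, t < min r r' :=
    (eventually_lt_nhds (lt_min hr hr')).filter_mono nhdsWithin_le_nhds
  obtain ⟨t, ht, htm, htp⟩ := (hv.and (hmem.and self_mem_nhdsWithin)).exists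
  have htp : (0 : ℝ) < t := htp
  have hd : ∀ s ∈ Set.Icc 0 t,
      HasDerivAt (fun t : ℝ => f (x + t • v)) ⟪p (x + s • v), v⟫ s := fun s hs => by
    apply hr1
    rw [Real.dist_eq, sub_zero, abs_of_nonneg hs.1]
    exact lt_of_le_of_lt hs.2 (htm.trans_le (min_le_left _ _))
  obtain ⟨s, hs, hs'⟩ := exists_hasDerivAt_eq_slope (fun t : ℝ => f (x + t • v))
    (fun s => ⟪p (x + s • v), v⟫) htp
    (fun s hs => (hd s hs).continuousAt.continuousWithinAt)
    (fun s hs => hd s ⟨hs.1.le, hs.2.le⟩)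
  have h7 : ⟪p (x + s • v), v⟫ < 0 :=
    hr2 ⟨hs.1, hs.2.trans (htm.trans_le (min_le_right _ _))⟩
  simp only [zero_smul, add_zero, sub_zero] at hs'
  have : 0 ≤ (f (x + t • v) - f x) / t := div_nonneg (by linarith) htp.le
  linarith

theorem eq_zero_of_isLocalMin (hf : HasHessianAt f p T x) (hx : IsLocalMin f x) : p x = 0 := by
  have := hx.hasFDerivAt_eq_zero hf.1.self_of_nhds
  have h := congrArg (fun l : E →L[ℝ] ℝ => l (p x)) this
  simpa using h

theorem inner_apply_nonneg_of_isLocalMin (hf : HasHessianAt f p T x) (hx : IsLocalMin f x)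
    (v : E) : 0 ≤ ⟪T v, v⟫ := by
  apply hf.inner_apply_nonneg (hf.eq_zero_of_isLocalMin hx)
  have htend : Tendsto (fun t : ℝ => x + t • v) (𝓝 0) (𝓝 x) := by
    have : Continuous (fun t : ℝ => x + t • v) := by fun_prop
    simpa using this.tendsto 0
  exact (htend.eventually hx).filter_mono nhdsWithin_le_nhds

end HasHessianAt

/-- A function which is nonnegative in a ball, vanishes at a boundary point and has nonpositive
inward derivative there has vanishing gradient and nonnegative second derivative there. -/
theorem HasHessianAt.gradient_eq_zero_and_nonneg_of_ball {f : E → ℝ} {p : E → E} {T : E →L[ℝ] E}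
    {x c : E} (hf : HasHessianAt f p T x) (hx : x ≠ c)
    (hnn : ∀ y ∈ closedBall c (dist x c), f x ≤ f y) (hp : ⟪p x, c - x⟫ ≤ 0) :
    p x = 0 ∧ ∀ v, 0 ≤ ⟪T v, v⟫ := by
  have key : ∀ v : E, 0 < ⟪v, c - x⟫ → ∀ᶠ t : ℝ in 𝓝[>] 0, f x ≤ f (x + t • v) := by
    intro v hv
    have h1 : ∀ᶠ t : ℝ in 𝓝 0, t * ‖v‖ ^ 2 < 2 * ⟪v, c - x⟫ := by
      have : Continuous fun t : ℝ => t * ‖v‖ ^ 2 := by fun_prop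
      exact (this.tendsto 0).eventually_lt_const (by simpa using hv)
    filter_upwards [h1.filter_mono nhdsWithin_le_nhds, self_mem_nhdsWithin] with t ht htp
    have htp : (0 : ℝ) < t := htp
    apply hnn
    rw [mem_closedBall, dist_eq_norm, dist_eq_norm]
    apply le_of_sq_le_sq _ (norm_nonneg _)
    have : x + t • v - c = t • v - (c - x) := by abel
    rw [this, norm_sub_sq_real, norm_smul, inner_smul_left, norm_sub_rev x c]
    simp only [Real.norm_eq_abs, abs_of_pos htp, conj_trivial, mul_pow]
    nlinarith
  have hcx : 0 < ‖c - x‖ ^ 2 := by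
    have : c - x ≠ 0 := sub_ne_zero.2 (Ne.symm hx)
    positivity
  have hp0 : p x = 0 := by
    -- Testing with the inward direction (c - x) - p x gives 0 ≤ ⟪p x, c - x⟫ - ‖p x‖², which forces
    -- p x = 0.
    have h2 : 0 < ⟪(c - x) - p x, c - x⟫ := by
      rw [inner_sub_left, real_inner_self_eq_norm_sq]; linarith
    have h3 := hf.inner_nonneg (key _ h2)
    rw [inner_sub_right, real_inner_self_eq_norm_sq] at h3
    have : ‖p x‖ ^ 2 = 0 := le_antisymm (by linarith) (by positivity)
    simpa using this
  refine ⟨hp0, ?_⟩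
  -- Tangential directions are limits of inward ones, and the quadratic form is even, so a closed
  -- half-space of directions suffices.
  have pos : ∀ v : E, 0 ≤ ⟪v, c - x⟫ → 0 ≤ ⟪T v, v⟫ := by
    intro v hv
    have hcont : Continuous fun s : ℝ => ⟪T (v + s • (c - x)), v + s • (c - x)⟫ := by fun_prop
    have hlim := (hcont.tendsto 0).mono_left (nhdsWithin_le_nhds (s := Set.Ioi 0))
    simp only [zero_smul, add_zero] at hlim
    refine ge_of_tendsto hlim ?_
    filter_upwards [self_mem_nhdsWithin] with s hs
    have hs : (0 : ℝ) < s := hs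
    apply hf.inner_apply_nonneg hp0
    apply key
    rw [inner_add_left, inner_smul_left, real_inner_self_eq_norm_sq]
    simp only [conj_trivial]
    positivity
  intro v
  rcases le_total 0 ⟪v, c - x⟫ with h | h
  · exact pos v h
  · have := pos (-v) (by rw [inner_neg_left]; linarith)
    simpa using this

end SecondOrder

/-! ### Elliptic level sets and the Hopf lemma for two touching solutions. -/

section Hopf

variable {E : Type*} [NormedAddCommGroup E] [InnerProductSpace ℝ E]

/-- The properties of a level set `{A ∈ U | F A = 1}` of an elliptic, orthogonally invariant
operator which are used by the method of moving spheres. -/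
structure EllipticLevelSet (𝓛 : Set (E →L[ℝ] E)) : Prop where
  eq_of_le : ∀ A ∈ 𝓛, ∀ B ∈ 𝓛, (∀ v, ⟪A v, v⟫ ≤ ⟪B v, v⟫) → A = B
  rank_one_le : ∀ A₀ ∈ 𝓛, ∃ K : ℝ, 0 < K ∧ ∃ N ∈ 𝓝 A₀, ∀ A ∈ N, A ∈ 𝓛 → ∀ B ∈ N, B ∈ 𝓛 →
    ∀ (a b : ℝ) (ζ : E), 0 ≤ a → 0 ≤ b →
      (∀ v, a * ⟪ζ, v⟫ ^ 2 - b * ‖v‖ ^ 2 ≤ ⟪(B - A) v, v⟫) → a * ‖ζ‖ ^ 2 ≤ K * b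
  conj : ∀ A ∈ 𝓛, ∀ R : E →L[ℝ] E, (∀ v w, ⟪R v, w⟫ = ⟪v, R w⟫) → (∀ v, R (R v) = v) →
    R ∘L A ∘L R ∈ 𝓛

/-- The conformal Hessian `ξ ∇²ξ - |∇ξ|² / 2` in terms of the value, the gradient and the second
derivative of `ξ = u ^ (-2 / (n - 2))`. -/
noncomputable def jetHessian (s : ℝ) (p : E) (X : E →L[ℝ] E) : E →L[ℝ] E :=
  s • X - (‖p‖ ^ 2 / 2) • ContinuousLinearMap.id ℝ E

theorem inner_jetHessian (s : ℝ) (p : E) (X : E →L[ℝ] E) (v : E) :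
    ⟪jetHessian s p X v, v⟫ = s * ⟪X v, v⟫ - ‖p‖ ^ 2 / 2 * ‖v‖ ^ 2 := by
  simp [jetHessian, inner_sub_left, inner_smul_left]

/-- `ξ` is a positive twice continuously differentiable function in `O`, with gradient `p` and
second derivative `X`, whose conformal Hessian takes values in `𝓛`. -/
structure IsConformalSolution (𝓛 : Set (E →L[ℝ] E)) (O : Set E) (ξ : E → ℝ) (p : E → E)
    (X : E → E →L[ℝ] E) : Prop where
  pos : ∀ y ∈ O, 0 < ξ y
  hasFDerivAt : ∀ y ∈ O, HasFDerivAt ξ (innerSL ℝ (p y)) y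
  hasFDerivAt_grad : ∀ y ∈ O, HasFDerivAt p (X y) y
  continuousAt_hess : ∀ y ∈ O, ContinuousAt X y
  mem : ∀ y ∈ O, jetHessian (ξ y) (p y) (X y) ∈ 𝓛

namespace IsConformalSolution

variable {𝓛 : Set (E →L[ℝ] E)} {O : Set E} {ξ : E → ℝ} {p : E → E} {X : E → E →L[ℝ] E}

theorem mono {O' : Set E} (h : IsConformalSolution 𝓛 O ξ p X) (hO : O' ⊆ O) :
    IsConformalSolution 𝓛 O' ξ p X :=
  ⟨fun y hy => h.pos y (hO hy), fun y hy => h.hasFDerivAt y (hO hy),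
    fun y hy => h.hasFDerivAt_grad y (hO hy), fun y hy => h.continuousAt_hess y (hO hy),
    fun y hy => h.mem y (hO hy)⟩

theorem hasHessianAt (h : IsConformalSolution 𝓛 O ξ p X) (hO : IsOpen O) {y : E} (hy : y ∈ O) :
    HasHessianAt ξ p (X y) y :=
  ⟨by filter_upwards [hO.mem_nhds hy] with z hz using h.hasFDerivAt z hz, h.hasFDerivAt_grad y hy⟩

theorem continuousOn (h : IsConformalSolution 𝓛 O ξ p X) : ContinuousOn ξ O :=
  fun y hy => (h.hasFDerivAt y hy).continuousAt.continuousWithinAt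

theorem continuousAt_jetHessian (h : IsConformalSolution 𝓛 O ξ p X) {y : E} (hy : y ∈ O) :
    ContinuousAt (fun y => jetHessian (ξ y) (p y) (X y)) y := by
  have h1 := (h.hasFDerivAt y hy).continuousAt
  have h2 := (h.hasFDerivAt_grad y hy).continuousAt
  have h3 := h.continuousAt_hess y hy
  unfold jetHessian
  fun_prop

end IsConformalSolution

/-- The barrier `Q + β Q²`, `Q = d² - |y - c|²`. -/
theorem hasHessianAt_barrier (c : E) (d β : ℝ) (y : E) :
    HasHessianAt (fun y => (d ^ 2 - ‖y - c‖ ^ 2) + β * (d ^ 2 - ‖y - c‖ ^ 2) ^ 2)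
      (fun y => (-(2 + 4 * β * (d ^ 2 - ‖y - c‖ ^ 2))) • (y - c))
      ((-(2 + 4 * β * (d ^ 2 - ‖y - c‖ ^ 2))) • ContinuousLinearMap.id ℝ E +
        (8 * β) • (innerSL ℝ (y - c)).smulRight (y - c)) y := by
  have hQ : ∀ y : E, HasFDerivAt (fun y => d ^ 2 - ‖y - c‖ ^ 2) (-((2 : ℝ) • innerSL ℝ (y - c))) y := by
    intro y
    have := (((hasFDerivAt_id y).sub_const c).norm_sq).const_sub (d ^ 2)
    exact this.congr_fderiv (by ext v; simp)
  constructor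
  · refine Eventually.of_forall fun y => ?_
    have := (hQ y).add (((hQ y).pow 2).const_mul β)
    refine this.congr_fderiv ?_
    ext v
    simp
    ring
  · have h1 := (((hQ y).const_mul (4 * β)).const_add 2).neg.smul ((hasFDerivAt_id y).sub_const c)
    refine h1.congr_fderiv ?_
    ext v
    simp only [Pi.neg_apply, add_apply, smul_apply, ContinuousLinearMap.smulRight_apply,
      neg_apply, id_eq, smul_eq_mul, ContinuousLinearMap.id_apply, smul_smul]
    congr 2
    ring

/-- At an interior minimum of η - ξ - εg, every term of the difference of the conformal Hessians is
O(ε). The barrier contributes 8βε ζ⊗ζ, whose coefficient β can be taken large, while the error does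
not depend on β as long as βQ ≤ 1. In the error, 6 comes from the scalar part of the barrier's
Hessian, 2d² from (t - s)X and 6d from the gradients. -/
theorem jetHessian_barrier_bound {s t ε β Q d Λ η₀ : ℝ} {p q ζ : E} {X Y : E →L[ℝ] E}
    (hε : 0 < ε) (hβ : 0 ≤ β) (hΛ : 0 ≤ Λ) (hη₀ : 0 ≤ η₀) (hζ : ‖ζ‖ ≤ d) (hQ0 : 0 ≤ Q)
    (hzβ : β * Q ≤ 1) (hgr' : q = p - (ε * (2 + 4 * β * Q)) • ζ)
    (hhe : ∀ v, 0 ≤ ⟪(Y - X - ε • ((-(2 + 4 * β * Q)) • ContinuousLinearMap.id ℝ E +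
      (8 * β) • (innerSL ℝ ζ).smulRight ζ)) v, v⟫)
    (hX : ‖X‖ ≤ Λ) (hp : ‖p‖ ≤ Λ) (hq : ‖q‖ ≤ Λ) (htΛ : t ≤ Λ) (hη't : η₀ ≤ t)
    (hst : 0 ≤ t - s) (hst' : t - s ≤ ε * (2 * d ^ 2)) (v : E) :
    (ε * (8 * β * η₀)) * ⟪ζ, v⟫ ^ 2 - (ε * (Λ * (6 + 2 * d ^ 2 + 6 * d))) * ‖v‖ ^ 2 ≤
      ⟪(jetHessian t q Y - jetHessian s p X) v, v⟫ := by
  have hd : 0 ≤ d := (norm_nonneg _).trans hζ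
  have h1 := hhe v
  simp only [sub_apply, add_apply,
    smul_apply, inner_sub_left, inner_add_left, inner_smul_left,
    ContinuousLinearMap.smulRight_apply, ContinuousLinearMap.id_apply, conj_trivial,
    innerSL_apply_apply, real_inner_self_eq_norm_sq] at h1
  rw [sub_apply, inner_sub_left, inner_jetHessian, inner_jetHessian]
  have h2 : |⟪X v, v⟫| ≤ Λ * ‖v‖ ^ 2 := by
    calc |⟪X v, v⟫| ≤ ‖X v‖ * ‖v‖ := abs_real_inner_le_norm _ _
      _ ≤ (‖X‖ * ‖v‖) * ‖v‖ := by gcongr; exact X.le_opNorm v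
      _ ≤ (Λ * ‖v‖) * ‖v‖ := by gcongr
      _ = _ := by ring
  have h3 : ‖q‖ ^ 2 - ‖p‖ ^ 2 ≤ ε * (12 * d * Λ) := by
    have e1 : ‖q‖ ^ 2 - ‖p‖ ^ 2 = -(ε * (2 + 4 * β * Q) * ⟪ζ, q + p⟫) := by
      have : ⟪q - p, q + p⟫ = ‖q‖ ^ 2 - ‖p‖ ^ 2 := by
        rw [inner_add_right, inner_sub_left, inner_sub_left, real_inner_self_eq_norm_sq,
          real_inner_self_eq_norm_sq, real_inner_comm]; ring
      have e0 : q - p = -((ε * (2 + 4 * β * Q)) • ζ) := by rw [hgr']; abel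
      rw [← this, e0, inner_neg_left, real_inner_smul_left]
    have e2 : |⟪ζ, q + p⟫| ≤ d * (2 * Λ) := by
      calc |⟪ζ, q + p⟫| ≤ ‖ζ‖ * ‖q + p‖ := abs_real_inner_le_norm _ _
        _ ≤ d * (2 * Λ) := by
          gcongr
          exact (norm_add_le _ _).trans (by linarith)
    have e3 := (abs_le.1 e2).1
    have e4 : 2 + 4 * β * Q ≤ 6 := by linarith
    have e5 : 0 ≤ 2 + 4 * β * Q := by positivity
    rw [e1]
    calc -(ε * (2 + 4 * β * Q) * ⟪ζ, q + p⟫)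
        = ε * ((2 + 4 * β * Q) * (-⟪ζ, q + p⟫)) := by ring
      _ ≤ ε * ((2 + 4 * β * Q) * (d * (2 * Λ))) := by gcongr; linarith
      _ ≤ ε * (6 * (d * (2 * Λ))) := by gcongr
      _ = _ := by ring
  have h4 : -((t - s) * ⟪X v, v⟫) ≤ ε * (2 * d ^ 2) * (Λ * ‖v‖ ^ 2) := by
    have e1 := (abs_le.1 h2).1
    calc -((t - s) * ⟪X v, v⟫) = (t - s) * (-⟪X v, v⟫) := by ring
      _ ≤ (t - s) * (Λ * ‖v‖ ^ 2) := by gcongr; linarith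
      _ ≤ ε * (2 * d ^ 2) * (Λ * ‖v‖ ^ 2) := by
        gcongr
  have h5 : t * (ε * (8 * β * ⟪ζ, v⟫ ^ 2 - 6 * ‖v‖ ^ 2)) ≤
      t * (⟪Y v, v⟫ - ⟪X v, v⟫) := by
    have : 0 ≤ t := hη₀.trans hη't
    gcongr
    have : ε * ((2 + 4 * β * Q) * ‖v‖ ^ 2) ≤ ε * (6 * ‖v‖ ^ 2) := by
      gcongr; linarith
    nlinarith
  have h6 : η₀ * (ε * (8 * β * ⟪ζ, v⟫ ^ 2)) ≤ t * (ε * (8 * β * ⟪ζ, v⟫ ^ 2)) := by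
    gcongr
  have h7 : t * (ε * (6 * ‖v‖ ^ 2)) ≤ Λ * (ε * (6 * ‖v‖ ^ 2)) := by gcongr
  have h8 : (‖q‖ ^ 2 - ‖p‖ ^ 2) * ‖v‖ ^ 2 ≤ ε * (12 * d * Λ) * ‖v‖ ^ 2 := by gcongr
  linarith

variable [FiniteDimensional ℝ E]

set_option maxHeartbeats 1000000 in
/-- The Hopf lemma for two touching solutions. -/
theorem IsConformalSolution.hopf {𝓛 : Set (E →L[ℝ] E)} (h𝓛 : EllipticLevelSet 𝓛) {O : Set E}
    (hO : IsOpen O) {ξ η : E → ℝ} {p q : E → E} {X Y : E → E →L[ℝ] E}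
    (hξ : IsConformalSolution 𝓛 O ξ p X) (hη : IsConformalSolution 𝓛 O η q Y) {x c : E}
    (hxO : x ∈ O) (hxc : x ≠ c) (heq : ξ x = η x)
    (hball : ∀ y ∈ closedBall c (dist x c), y ≠ x → y ∈ O ∧ ξ y < η y)
    (hder : ⟪q x - p x, c - x⟫ ≤ 0) : False := by
  have hess := (hη.hasHessianAt hO hxO).sub (hξ.hasHessianAt hO hxO)
  have hnn : ∀ y ∈ closedBall c (dist x c), 0 ≤ η y - ξ y := by
    intro y hy
    by_cases h : y = x
    · rw [h, heq, sub_self]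
    · linarith [(hball y hy h).2]
  obtain ⟨hgrad, hX⟩ := hess.gradient_eq_zero_and_nonneg_of_ball hxc
    (fun y hy => by simpa [heq] using hnn y hy) hder
  have hgrad : q x = p x := sub_eq_zero.1 hgrad
  -- Values and gradients agree at x and the Hessians are ordered, so ellipticity forces equality.
  -- Hence near x both conformal Hessians stay in one neighbourhood on which K is uniform.
  have hA : jetHessian (ξ x) (p x) (X x) = jetHessian (η x) (q x) (Y x) := by
    apply h𝓛.eq_of_le _ (hξ.mem x hxO) _ (hη.mem x hxO)
    intro v
    rw [inner_jetHessian, inner_jetHessian, hgrad, heq]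
    have h1 := hX v
    rw [sub_apply, inner_sub_left] at h1
    nlinarith [hη.pos x hxO]
  obtain ⟨K, hK, N, hN, hKN⟩ := h𝓛.rank_one_le _ (hξ.mem x hxO)
  set d := dist x c with hd
  have hd0 : 0 < d := dist_pos.2 hxc
  obtain ⟨Λ, hΛ1, hΛ2, hΛ3, hΛ4⟩ : ∃ Λ, ‖X x‖ < Λ ∧ ‖p x‖ < Λ ∧ ‖q x‖ < Λ ∧ η x < Λ := by
    refine ⟨max (max ‖X x‖ ‖p x‖) (max ‖q x‖ (η x)) + 1, ?_, ?_, ?_, ?_⟩ <;>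
      apply lt_add_of_le_of_pos _ one_pos <;> simp
  have hΛ : 0 < Λ := (norm_nonneg _).trans_lt hΛ1
  set η₀ := η x / 2 with hη₀
  have hη₀pos : 0 < η₀ := half_pos (hη.pos x hxO)
  set b₀ := Λ * (6 + 2 * d ^ 2 + 6 * d) with hb₀
  have hb₀pos : 0 < b₀ := by positivity
  -- Near x one has |y - c|² ≥ d²/4, and this β makes 8βη₀·d²/4 = 2(K b₀ + 1), which exceeds K b₀.
  set β := (K * b₀ + 1) / (η₀ * d ^ 2) with hβ
  have hβpos : 0 < β := by positivity
  have hcont1 : ContinuousAt (fun y : E => d ^ 2 - ‖y - c‖ ^ 2) x := by fun_prop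
  have hQx : d ^ 2 - ‖x - c‖ ^ 2 = 0 := by rw [hd, dist_eq_norm, sub_self]
  have hnear : ∀ᶠ y in 𝓝 x, y ∈ O ∧ jetHessian (ξ y) (p y) (X y) ∈ N ∧
      jetHessian (η y) (q y) (Y y) ∈ N ∧ ‖X y‖ < Λ ∧ ‖p y‖ < Λ ∧ ‖q y‖ < Λ ∧ η y < Λ ∧ η₀ < η y ∧
      β * (d ^ 2 - ‖y - c‖ ^ 2) < 1 ∧ (d ^ 2 - ‖y - c‖ ^ 2) < 3 / 4 * d ^ 2 := by
    have e1 := (hξ.continuousAt_jetHessian hxO).eventually_mem hN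
    have e2 := (hη.continuousAt_jetHessian hxO).eventually_mem (hA ▸ hN)
    have e3 := (hξ.continuousAt_hess x hxO).norm.tendsto.eventually_lt_const hΛ1
    have e4 := (hξ.hasFDerivAt_grad x hxO).continuousAt.norm.tendsto.eventually_lt_const hΛ2
    have e5 := (hη.hasFDerivAt_grad x hxO).continuousAt.norm.tendsto.eventually_lt_const hΛ3
    have e6 := (hη.hasFDerivAt x hxO).continuousAt.tendsto.eventually_lt_const hΛ4
    have e7 := (hη.hasFDerivAt x hxO).continuousAt.eventually_const_lt
      (half_lt_self (hη.pos x hxO))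
    have e8 := Tendsto.eventually_lt_const (u := 1) (by rw [hQx]; simp) (hcont1.const_mul β).tendsto
    have e9 := Tendsto.eventually_lt_const (u := 3 / 4 * d ^ 2) (by rw [hQx]; positivity) hcont1.tendsto
    filter_upwards [hO.mem_nhds hxO, e1, e2, e3, e4, e5, e6, e7, e8, e9]
      with y h0 h1 h2 h3 h4 h5 h6 h7 h8 h9
    exact ⟨h0, h1, h2, h3, h4, h5, h6, h7, h8, h9⟩
  obtain ⟨s, hs, hnear⟩ := Metric.nhds_basis_closedBall.eventually_iff.1 hnear
  set g : E → ℝ := fun y => (d ^ 2 - ‖y - c‖ ^ 2) + β * (d ^ 2 - ‖y - c‖ ^ 2) ^ 2 with hg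
  have hgle : ∀ y ∈ closedBall c d ∩ closedBall x s, g y ≤ 2 * d ^ 2 := by
    rintro y ⟨hy1, hy2⟩
    obtain ⟨-, -, -, -, -, -, -, -, h8, -⟩ := hnear hy2
    have hQ0 : 0 ≤ d ^ 2 - ‖y - c‖ ^ 2 := by
      rw [mem_closedBall, dist_eq_norm] at hy1
      nlinarith [norm_nonneg (y - c)]
    have : g y = (d ^ 2 - ‖y - c‖ ^ 2) + β * (d ^ 2 - ‖y - c‖ ^ 2) * (d ^ 2 - ‖y - c‖ ^ 2) := by
      rw [hg]; ring
    rw [this]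
    nlinarith [sq_nonneg ‖y - c‖]
  have hhcont : ContinuousOn (fun y => η y - ξ y) O := hη.continuousOn.sub hξ.continuousOn
  obtain ⟨μ, hμ, hμC⟩ : ∃ μ, 0 < μ ∧ ∀ y ∈ closedBall c d ∩ sphere x s, μ ≤ η y - ξ y := by
    apply IsCompact.exists_forall_le' ((isCompact_closedBall c d).inter_right isClosed_sphere)
    · exact hhcont.mono fun y hy => (hnear (sphere_subset_closedBall hy.2)).1
    · rintro y ⟨hy1, hy2⟩
      have : y ≠ x := by rintro rfl; simp at hy2; exact hs.ne hy2
      linarith [(hball y hy1 this).2]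
  set ε := μ / (2 * d ^ 2 + 1) with hε
  have hεpos : 0 < ε := by positivity
  have hεd : ε * (2 * d ^ 2) < μ := by
    have : ε * (2 * d ^ 2 + 1) = μ := by rw [hε]; field_simp
    linarith
  have hφhess : ∀ z ∈ O, HasHessianAt (fun y => (η y - ξ y) - ε * g y) _ _ z := fun z hz =>
    ((hη.hasHessianAt hO hz).sub (hξ.hasHessianAt hO hz)).sub
      ((hasHessianAt_barrier c d β z).const_mul ε)
  have hxD : x ∈ closedBall c d ∩ closedBall x s :=
    ⟨by rw [mem_closedBall], mem_closedBall_self hs.le⟩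
  obtain ⟨z, hzD, hz⟩ := IsCompact.exists_isMinOn
    ((isCompact_closedBall c d).inter (isCompact_closedBall x s)) ⟨x, hxD⟩
    (f := fun y => (η y - ξ y) - ε * g y)
    ((hhcont.mono fun y hy => (hnear hy.2).1).sub (by rw [hg]; fun_prop))
  obtain ⟨hzO, hzN1, hzN2, hzX, hzp, hzq, hzη, hzη', hzβ, hzd⟩ := hnear hzD.2
  -- A negative minimum cannot lie on the sphere about c, where g = 0, nor on the sphere about x,
  -- where εg < μ. In the interior it contradicts `rank_one_le`.
  have hφz : 0 ≤ (η z - ξ z) - ε * g z := by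
    by_contra! hneg
    have hz1 : z ∈ ball c d := by
      refine lt_of_le_of_ne (mem_closedBall.1 hzD.1) fun h => ?_
      rw [dist_eq_norm] at h
      have : g z = 0 := by rw [hg]; simp [h]
      rw [this] at hneg
      linarith [hnn z hzD.1]
    have hz2 : z ∈ ball x s := by
      refine lt_of_le_of_ne (mem_closedBall.1 hzD.2) fun h => ?_
      have h1 := hμC z ⟨hzD.1, h⟩
      have h2 := hgle z hzD
      nlinarith
    have hmin : IsLocalMin (fun y => (η y - ξ y) - ε * g y) z := by
      filter_upwards [isOpen_ball.mem_nhds hz1, isOpen_ball.mem_nhds hz2] with y hy1 hy2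
      exact hz ⟨ball_subset_closedBall hy1, ball_subset_closedBall hy2⟩
    have hgr := (hφhess z hzO).eq_zero_of_isLocalMin hmin
    have hhe := (hφhess z hzO).inner_apply_nonneg_of_isLocalMin hmin
    have hzc : ‖z - c‖ ≤ d := by rw [← dist_eq_norm]; exact hzD.1
    set ζ := z - c with hζ
    clear_value ζ
    set Q := d ^ 2 - ‖ζ‖ ^ 2 with hQ
    have hQ0 : 0 ≤ Q := by nlinarith [norm_nonneg (ζ)]
    have hgr' : q z = p z - (ε * (2 + 4 * β * Q)) • (ζ) := by
      have : q z - p z = (ε * (-(2 + 4 * β * Q))) • (ζ) := by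
        rw [← smul_smul]; exact sub_eq_zero.1 hgr
      rw [eq_add_of_sub_eq this, mul_neg, neg_smul]; abel
    have hh0 := hnn z hzD.1
    have hgz := hgle z hzD
    have hbound : ∀ v, (ε * (8 * β * η₀)) * ⟪ζ, v⟫ ^ 2 - (ε * b₀) * ‖v‖ ^ 2 ≤
        ⟪(jetHessian (η z) (q z) (Y z) - jetHessian (ξ z) (p z) (X z)) v, v⟫ := by
      exact jetHessian_barrier_bound hεpos hβpos.le hΛ.le hη₀pos.le hzc hQ0 hzβ.le hgr' hhe hzX.le
        hzp.le hzq.le hzη.le hzη'.le hh0 (by nlinarith)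
    have hfin := hKN _ hzN1 (hξ.mem z hzO) _ hzN2 (hη.mem z hzO) (ε * (8 * β * η₀)) (ε * b₀)
      ζ (by positivity) (by positivity) hbound
    have e1 : ε * (8 * β * η₀) * (d ^ 2 / 4) ≤ ε * (8 * β * η₀) * ‖ζ‖ ^ 2 := by
      gcongr; linarith
    have e2 : β * (η₀ * d ^ 2) = K * b₀ + 1 := by
      rw [hβ]; field_simp
    have e3 : ε * (8 * β * η₀) * (d ^ 2 / 4) = ε * (2 * (K * b₀ + 1)) := by rw [← e2]; ring
    have : 0 < ε * (K * b₀ + 2) := by positivity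
    linarith
  have hφx : (η x - ξ x) - ε * g x = 0 := by
    have : g x = 0 := by rw [hg]; simp only [hQx]; ring
    rw [this, heq]; ring
  -- Along c - x the difference η - ξ has zero derivative at x, while g has derivative 2d². This is
  -- incompatible with η - ξ ≥ εg.
  have hfirst := (hφhess x hxO).inner_nonneg (v := c - x) (by
    have h1 : ∀ᶠ t : ℝ in 𝓝 0, t < 1 ∧ t * d < s := by
      have : Continuous fun t : ℝ => t * d := by fun_prop
      exact (eventually_lt_nhds one_pos).and
        ((this.tendsto 0).eventually_lt_const (by simpa using hs))
    filter_upwards [h1.filter_mono nhdsWithin_le_nhds, self_mem_nhdsWithin] with t ht htp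
    have htp : (0 : ℝ) < t := htp
    rw [hφx]
    refine hφz.trans (hz ⟨?_, ?_⟩)
    · rw [mem_closedBall, dist_eq_norm]
      have : x + t • (c - x) - c = (1 - t) • (x - c) := by
        rw [sub_smul, one_smul, smul_sub, smul_sub]; abel
      rw [this, norm_smul, Real.norm_eq_abs, abs_of_pos (by linarith), ← dist_eq_norm, ← hd]
      nlinarith
    · rw [mem_closedBall, dist_eq_norm, add_sub_cancel_left, norm_smul, Real.norm_eq_abs,
        abs_of_pos htp, norm_sub_rev, ← dist_eq_norm]
      exact ht.2.le)
  simp only [hQx, hgrad, sub_self, zero_sub, inner_neg_left, inner_smul_left, conj_trivial] at hfirst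
  have h2 : ⟪x - c, c - x⟫ = -d ^ 2 := by
    rw [← neg_sub x c, inner_neg_right, real_inner_self_eq_norm_sq, hd, dist_eq_norm]
  rw [h2] at hfirst
  have : 0 < ε * d ^ 2 := by positivity
  linarith

end Hopf

/-! ### The Kelvin transform and conformal invariance. -/

section Kelvin

variable {E : Type*} [NormedAddCommGroup E] [InnerProductSpace ℝ E]

/-- The inversion in the sphere of radius `√κ` centred at the origin. -/
noncomputable def sphereInversion (κ : ℝ) (y : E) : E := (κ * (‖y‖ ^ 2)⁻¹) • y

/-- The reflection in the hyperplane orthogonal to `y`. -/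
noncomputable def hyperplaneReflection (y : E) : E →L[ℝ] E :=
  ContinuousLinearMap.id ℝ E - (2 * (‖y‖ ^ 2)⁻¹) • (innerSL ℝ y).smulRight y

theorem hyperplaneReflection_apply (y v : E) :
    hyperplaneReflection y v = v - (2 * (‖y‖ ^ 2)⁻¹ * ⟪y, v⟫) • y := by
  simp [hyperplaneReflection, smul_smul]

theorem inner_hyperplaneReflection (y v w : E) :
    ⟪hyperplaneReflection y v, w⟫ = ⟪v, hyperplaneReflection y w⟫ := by
  simp only [hyperplaneReflection_apply, inner_sub_left, inner_sub_right, inner_smul_left,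
    inner_smul_right, conj_trivial, real_inner_comm v y]
  ring

theorem hyperplaneReflection_involutive {y : E} (hy : y ≠ 0) (v : E) :
    hyperplaneReflection y (hyperplaneReflection y v) = v := by
  have : ‖y‖ ^ 2 ≠ 0 := by simpa using hy
  simp only [hyperplaneReflection_apply, inner_sub_right, inner_smul_right,
    real_inner_self_eq_norm_sq]
  match_scalars <;> field_simp
  ring

theorem hasFDerivAt_norm_sq_inv {y : E} (hy : y ≠ 0) :
    HasFDerivAt (fun y : E => (‖y‖ ^ 2)⁻¹) (-(2 * ((‖y‖ ^ 2)⁻¹) ^ 2) • innerSL ℝ y) y := by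
  have h0 : ‖y‖ ^ 2 ≠ 0 := by simpa using hy
  have h1 : HasFDerivAt (fun y : E => ‖y‖ ^ 2) ((2 : ℝ) • innerSL ℝ y) y :=
    ((hasFDerivAt_id y).norm_sq).congr_fderiv (by ext v; simp)
  have := (hasDerivAt_inv h0).comp_hasFDerivAt y h1
  refine this.congr_fderiv ?_
  ext v
  simp
  ring

theorem hasFDerivAt_sphereInversion (κ : ℝ) {y : E} (hy : y ≠ 0) :
    HasFDerivAt (sphereInversion κ) ((κ * (‖y‖ ^ 2)⁻¹) • hyperplaneReflection y) y := by
  have h := ((hasFDerivAt_norm_sq_inv hy).const_mul κ).smul (hasFDerivAt_id y)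
  refine h.congr_fderiv ?_
  ext v
  simp only [add_apply, smul_apply, ContinuousLinearMap.smulRight_apply, id_eq, smul_eq_mul,
    ContinuousLinearMap.id_apply, hyperplaneReflection_apply, innerSL_apply_apply]
  module

/-- The Kelvin transform `ξ_λ`, `λ² = κ`. -/
noncomputable def kelvin (κ : ℝ) (ξ : E → ℝ) (y : E) : ℝ :=
  κ⁻¹ * ‖y‖ ^ 2 * ξ (sphereInversion κ y)

/-- The gradient of the Kelvin transform. -/
noncomputable def kelvinGrad (κ : ℝ) (ξ : E → ℝ) (p : E → E) (y : E) : E :=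
  (2 * κ⁻¹ * ξ (sphereInversion κ y)) • y + hyperplaneReflection y (p (sphereInversion κ y))

/-- The second derivative of the Kelvin transform. -/
noncomputable def kelvinHess (κ : ℝ) (ξ : E → ℝ) (p : E → E) (X : E → E →L[ℝ] E) (y : E) :
    E →L[ℝ] E :=
  (κ * (‖y‖ ^ 2)⁻¹) •
      (hyperplaneReflection y ∘L X (sphereInversion κ y) ∘L hyperplaneReflection y) +
    (2 * κ⁻¹ * ξ (sphereInversion κ y) - 2 * (‖y‖ ^ 2)⁻¹ * ⟪y, p (sphereInversion κ y)⟫) •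
      ContinuousLinearMap.id ℝ E

/-- The conformal invariance of the conformal Hessian. -/
theorem jetHessian_kelvin {κ : ℝ} (hκ : κ ≠ 0) (ξ : E → ℝ) (p : E → E) (X : E → E →L[ℝ] E)
    {y : E} (hy : y ≠ 0) :
    jetHessian (kelvin κ ξ y) (kelvinGrad κ ξ p y) (kelvinHess κ ξ p X y) =
      hyperplaneReflection y ∘L
        jetHessian (ξ (sphereInversion κ y)) (p (sphereInversion κ y)) (X (sphereInversion κ y)) ∘L
          hyperplaneReflection y := by
  have h0 : ‖y‖ ^ 2 ≠ 0 := by simpa using hy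
  have hR := hyperplaneReflection_involutive hy
  have hq : ‖kelvinGrad κ ξ p y‖ ^ 2 = (2 * κ⁻¹ * ξ (sphereInversion κ y)) ^ 2 * ‖y‖ ^ 2 +
      ‖p (sphereInversion κ y)‖ ^ 2 -
        4 * κ⁻¹ * ξ (sphereInversion κ y) * ⟪y, p (sphereInversion κ y)⟫ := by
    have h1 : ‖hyperplaneReflection y (p (sphereInversion κ y))‖ ^ 2 =
        ‖p (sphereInversion κ y)‖ ^ 2 := by
      rw [← real_inner_self_eq_norm_sq, inner_hyperplaneReflection, hR, real_inner_self_eq_norm_sq]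
    have h2 : ⟪y, hyperplaneReflection y (p (sphereInversion κ y))⟫ =
        -⟪y, p (sphereInversion κ y)⟫ := by
      rw [hyperplaneReflection_apply, inner_sub_right, inner_smul_right, real_inner_self_eq_norm_sq]
      field_simp
      ring
    rw [kelvinGrad, norm_add_sq_real, h1, inner_smul_left, h2, norm_smul, mul_pow]
    simp only [Real.norm_eq_abs, sq_abs, conj_trivial]
    ring
  ext1 v
  simp only [jetHessian, hq, kelvin, kelvinHess, sub_apply, smul_apply, add_apply,
    ContinuousLinearMap.comp_apply, ContinuousLinearMap.id_apply, map_sub, map_smul, hR]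
  match_scalars <;> field_simp
  ring

variable {𝓛 : Set (E →L[ℝ] E)} {O : Set E} {ξ : E → ℝ} {p : E → E} {X : E → E →L[ℝ] E}

/-- The derivative of the inversion is a multiple of a reflection, so the conformal Hessian is
merely conjugated by a symmetric involution, under which 𝓛 is invariant. -/
theorem IsConformalSolution.kelvin_transform (h𝓛 : EllipticLevelSet 𝓛) {κ : ℝ} (hκ : 0 < κ)
    (h : IsConformalSolution 𝓛 O ξ p X) :
    IsConformalSolution 𝓛 {y | y ≠ 0 ∧ sphereInversion κ y ∈ O} (kelvin κ ξ) (kelvinGrad κ ξ p)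
      (kelvinHess κ ξ p X) := by
  refine ⟨?_, ?_, ?_, ?_, ?_⟩
  · rintro y ⟨hy, hyO⟩
    have := h.pos _ hyO
    have h0 : 0 < ‖y‖ := norm_pos_iff.2 hy
    unfold kelvin
    positivity
  · rintro y ⟨hy, hyO⟩
    have h0 : ‖y‖ ^ 2 ≠ 0 := by simpa using hy
    have h1 : HasFDerivAt (fun y : E => ‖y‖ ^ 2) ((2 : ℝ) • innerSL ℝ y) y :=
      ((hasFDerivAt_id y).norm_sq).congr_fderiv (by ext v; simp)
    have h2 := (h.hasFDerivAt _ hyO).comp y (hasFDerivAt_sphereInversion κ hy)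
    have h3 := (h1.const_mul κ⁻¹).mul h2
    refine h3.congr_fderiv ?_
    ext v
    simp only [add_apply, smul_apply, ContinuousLinearMap.comp_apply, smul_eq_mul,
      innerSL_apply_apply, kelvinGrad, inner_add_left, inner_smul_left, conj_trivial,
      inner_smul_right, inner_hyperplaneReflection, Function.comp_apply]
    field_simp
    ring
  · rintro y ⟨hy, hyO⟩
    have h0 : ‖y‖ ^ 2 ≠ 0 := by simpa using hy
    have hψ := hasFDerivAt_sphereInversion κ hy
    have h1 := (h.hasFDerivAt _ hyO).comp y hψ
    have h2 := (h.hasFDerivAt_grad _ hyO).comp y hψ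
    have h3 := (h1.const_mul (2 * κ⁻¹)).smul (hasFDerivAt_id y)
    have h4 := ((((hasFDerivAt_norm_sq_inv hy).const_mul 2).mul
      ((hasFDerivAt_id y).inner ℝ h2))).smul (hasFDerivAt_id y)
    have h5 := h3.add (h2.sub h4)
    have hfun : kelvinGrad κ ξ p = fun y => (2 * κ⁻¹ * ξ (sphereInversion κ y)) • y +
        (p (sphereInversion κ y) -
          (2 * (‖y‖ ^ 2)⁻¹ * ⟪y, p (sphereInversion κ y)⟫) • y) := by
      funext y
      rw [kelvinGrad, hyperplaneReflection_apply]
    rw [hfun]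
    refine HasFDerivAt.congr_fderiv (f := fun y => (2 * κ⁻¹ * ξ (sphereInversion κ y)) • y +
        (p (sphereInversion κ y) -
          (2 * (‖y‖ ^ 2)⁻¹ * ⟪y, p (sphereInversion κ y)⟫) • y)) h5 ?_
    ext1 v
    simp only [kelvinHess, add_apply, sub_apply, smul_apply, ContinuousLinearMap.comp_apply,
      smul_eq_mul, innerSL_apply_apply, ContinuousLinearMap.smulRight_apply, id_eq,
      Function.comp_apply, Pi.mul_apply, ContinuousLinearMap.id_apply, fderivInnerCLM_apply,
      ContinuousLinearMap.prod_apply, inner_smul_right, map_smul]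
    set w := X (sphereInversion κ y) ((hyperplaneReflection y) v)
    simp only [hyperplaneReflection_apply, inner_sub_right, inner_smul_right]
    rw [real_inner_comm v, real_inner_comm y (p (sphereInversion κ y))]
    match_scalars <;> field_simp <;> ring
  · rintro y ⟨hy, hyO⟩
    have h0 : ‖y‖ ^ 2 ≠ 0 := by simpa using hy
    have hψ := (hasFDerivAt_sphereInversion κ hy).continuousAt
    have h1 : ContinuousAt (fun y => ξ (sphereInversion κ y)) y :=
      (h.hasFDerivAt _ hyO).continuousAt.comp hψ
    have h2 : ContinuousAt (fun y => p (sphereInversion κ y)) y :=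
      (h.hasFDerivAt_grad _ hyO).continuousAt.comp hψ
    have h3 : ContinuousAt (fun y => X (sphereInversion κ y)) y :=
      (h.continuousAt_hess _ hyO).comp (f := sphereInversion κ) hψ
    have h4 : ContinuousAt (fun y : E => (‖y‖ ^ 2)⁻¹) y := (hasFDerivAt_norm_sq_inv hy).continuousAt
    have h5 : ContinuousAt (fun y : E => hyperplaneReflection y) y := by
      unfold hyperplaneReflection
      have : ContinuousAt (fun y : E => (innerSL ℝ y).smulRight y) y :=
        (((ContinuousLinearMap.smulRightL ℝ E E).continuous.comp
          (innerSL ℝ).continuous).clm_apply continuous_id).continuousAt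
      fun_prop
    have h6 := h5.clm_comp (h3.clm_comp h5)
    have h7 : ContinuousAt (fun y => 2 * κ⁻¹ * ξ (sphereInversion κ y) -
        2 * (‖y‖ ^ 2)⁻¹ * ⟪y, p (sphereInversion κ y)⟫) y :=
      (continuousAt_const.mul h1).sub ((continuousAt_const.mul h4).mul (continuousAt_id.inner (𝕜 := ℝ) h2))
    exact ((continuousAt_const.mul h4).smul h6).add (h7.smul continuousAt_const)
  · rintro y ⟨hy, hyO⟩
    rw [jetHessian_kelvin hκ.ne' _ _ _ hy]
    exact h𝓛.conj _ (h.mem _ hyO) _ (inner_hyperplaneReflection y)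
      (hyperplaneReflection_involutive hy)

theorem IsConformalSolution.translate (h : IsConformalSolution 𝓛 O ξ p X) (a : E) :
    IsConformalSolution 𝓛 {y | a + y ∈ O} (fun y => ξ (a + y)) (fun y => p (a + y))
      (fun y => X (a + y)) := by
  have ht : ∀ y : E, HasFDerivAt (fun y : E => a + y) (ContinuousLinearMap.id ℝ E) y :=
    fun y => (hasFDerivAt_id y).const_add a
  refine ⟨fun y hy => h.pos _ hy, fun y hy => ?_, fun y hy => ?_, fun y hy => ?_,
    fun y hy => h.mem _ hy⟩
  · exact (h.hasFDerivAt _ hy).comp y (ht y)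
  · exact (h.hasFDerivAt_grad _ hy).comp y (ht y)
  · exact (h.continuousAt_hess _ hy).comp (f := fun y => a + y) (ht y).continuousAt

end Kelvin

/-! ### The method of moving spheres. -/

section MovingSpheres

variable {E : Type*} [NormedAddCommGroup E] [InnerProductSpace ℝ E]

theorem norm_sphereInversion {κ : ℝ} (hκ : 0 < κ) (y : E) :
    ‖sphereInversion κ y‖ = κ * ‖y‖⁻¹ := by
  rw [sphereInversion, norm_smul, Real.norm_eq_abs, abs_of_nonneg (by positivity)]
  rcases eq_or_ne ‖y‖ 0 with h | h
  · simp [h]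
  · field_simp

/-- The conformal factors `t ↦ ξ (t y) / t` fail to be strictly decreasing on `[τ, 1]`. -/
def FailsDecrease (ξ : E → ℝ) (p : E → E) (τ : ℝ) (y : E) : Prop :=
  (τ < 1 ∧ ξ (τ • y) ≤ τ * ξ y) ∨ (τ = 1 ∧ ξ y ≤ ⟪p y, y⟫)

/-- By the mean value theorem for ξ(ty)/t, both kinds of failure give one radial inequality, which
survives limits τ → 1 and is impossible near the origin. -/
theorem FailsDecrease.exists_le_inner {ξ : E → ℝ} {p : E → E} {τ : ℝ} {y : E}
    (h : FailsDecrease ξ p τ y) (hτ : 0 < τ)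
    (hd : ∀ t ∈ Set.Icc τ 1, HasFDerivAt ξ (innerSL ℝ (p (t • y))) (t • y)) :
    ∃ t ∈ Set.Icc τ 1, ξ (t • y) ≤ ⟪p (t • y), t • y⟫ := by
  rcases h with ⟨h1, h⟩ | ⟨h1, h⟩
  · have hder : ∀ t ∈ Set.Icc τ 1, HasDerivAt (fun t : ℝ => ξ (t • y) / t)
        ((⟪p (t • y), y⟫ * t - ξ (t • y) * 1) / t ^ 2) t := by
      intro t ht
      have hl : HasDerivAt (fun t : ℝ => t • y) y t := by
        simpa using (hasDerivAt_id t).smul_const y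
      have h2 : HasDerivAt (fun t : ℝ => ξ (t • y)) ⟪p (t • y), y⟫ t := by
        simpa [Function.comp_def] using (hd t ht).comp_hasDerivAt t hl
      exact h2.div (hasDerivAt_id t) (hτ.trans_le ht.1).ne'
    obtain ⟨t, ht, hts⟩ := exists_hasDerivAt_eq_slope _ _ h1
      (fun t ht => (hder t ht).continuousAt.continuousWithinAt)
      (fun t ht => hder t ⟨ht.1.le, ht.2.le⟩)
    have ht0 : 0 < t := hτ.trans ht.1
    refine ⟨t, ⟨ht.1.le, ht.2.le⟩, ?_⟩
    have h3 : 0 ≤ (⟪p (t • y), y⟫ * t - ξ (t • y) * 1) / t ^ 2 := by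
      rw [hts]
      apply div_nonneg _ (by linarith)
      rw [one_smul, div_one, sub_nonneg, div_le_iff₀ hτ]
      linarith
    have h4 : 0 ≤ ⟪p (t • y), y⟫ * t - ξ (t • y) * 1 := by
      have := mul_nonneg h3 (sq_nonneg t)
      rwa [div_mul_cancel₀ _ (by positivity)] at this
    rw [inner_smul_right]
    linarith
  · subst h1
    exact ⟨1, ⟨le_rfl, le_rfl⟩, by simpa using h⟩

theorem smul_mem_closedBall_zero {L t : ℝ} {y : E} (hy : ‖y‖ ≤ L) (h0 : 0 ≤ t) (h1 : t ≤ 1) :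
    t • y ∈ closedBall (0 : E) L := by
  rw [mem_closedBall_zero_iff, norm_smul, Real.norm_eq_abs, abs_of_nonneg h0]
  nlinarith [norm_nonneg y]

variable {𝓛 : Set (E →L[ℝ] E)} {O : Set E} {ξ : E → ℝ} {p : E → E} {X : E → E →L[ℝ] E}

/-- The set of failures is closed. -/
theorem IsConformalSolution.failsDecrease_of_tendsto (h : IsConformalSolution 𝓛 O ξ p X)
    {L : ℝ} (hball : closedBall (0 : E) L ⊆ O) {τ : ℕ → ℝ} {y : ℕ → E} {τ' : ℝ} {y' : E}
    (hτ : Tendsto τ atTop (𝓝 τ')) (hy : Tendsto y atTop (𝓝 y'))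
    (hτ0 : ∀ k, 0 < τ k) (hτ1 : ∀ k, τ k ≤ 1) (hyL : ∀ k, ‖y k‖ ≤ L)
    (hfail : ∀ k, FailsDecrease ξ p (τ k) (y k)) : FailsDecrease ξ p τ' y' := by
  have hτ0' : 0 ≤ τ' := ge_of_tendsto' hτ fun k => (hτ0 k).le
  have hτ1' : τ' ≤ 1 := le_of_tendsto' hτ hτ1
  have hyL' : ‖y'‖ ≤ L := le_of_tendsto' hy.norm hyL
  have hy'O : y' ∈ O := hball (mem_closedBall_zero_iff.2 hyL')
  rcases hτ1'.lt_or_eq with hlt | heq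
  · refine Or.inl ⟨hlt, ?_⟩
    have hO : τ' • y' ∈ O := hball (smul_mem_closedBall_zero hyL' hτ0' hτ1')
    have h1 : Tendsto (fun k => ξ (τ k • y k)) atTop (𝓝 (ξ (τ' • y'))) :=
      (h.hasFDerivAt _ hO).continuousAt.tendsto.comp (hτ.smul hy)
    have h2 : Tendsto (fun k => τ k * ξ (y k)) atTop (𝓝 (τ' * ξ y')) :=
      hτ.mul ((h.hasFDerivAt _ hy'O).continuousAt.tendsto.comp hy)
    apply le_of_tendsto_of_tendsto h1 h2
    filter_upwards [hτ.eventually_lt_const hlt] with k hk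
    rcases hfail k with h3 | h3
    · exact h3.2
    · exact absurd h3.1 hk.ne
  · refine Or.inr ⟨heq, ?_⟩
    -- The inequality for the values is trivial in the limit τ = 1. The intermediate points,
    -- squeezed towards y', carry the derivative condition instead.
    have := fun k => (hfail k).exists_le_inner (hτ0 k) (fun t ht => h.hasFDerivAt _
      (hball (smul_mem_closedBall_zero (hyL k) ((hτ0 k).le.trans ht.1) ht.2)))
    choose t ht htle using this
    have ht1 : Tendsto t atTop (𝓝 1) :=
      tendsto_of_tendsto_of_tendsto_of_le_of_le (heq ▸ hτ) tendsto_const_nhds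
        (fun k => (ht k).1) (fun k => (ht k).2)
    have hty : Tendsto (fun k => t k • y k) atTop (𝓝 y') := by simpa using ht1.smul hy
    have h1 := (h.hasFDerivAt _ hy'O).continuousAt.tendsto.comp hty
    have h2 := ((h.hasFDerivAt_grad _ hy'O).continuousAt.tendsto.comp hty).inner (𝕜 := ℝ) hty
    exact le_of_tendsto_of_tendsto' h1 h2 htle

variable [FiniteDimensional ℝ E]

/-- Small spheres are admissible. -/
theorem IsConformalSolution.exists_le_of_failsDecrease (h : IsConformalSolution 𝓛 O ξ p X)
    {L : ℝ} (hL : 0 < L) (hball : closedBall (0 : E) L ⊆ O) :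
    ∃ ε > 0, ∀ (τ : ℝ) (y : E), 0 < τ → τ ≤ 1 → ‖y‖ ≤ L → FailsDecrease ξ p τ y →
      ε ≤ τ * ‖y‖ ^ 2 := by
  have h0L : (0 : E) ∈ closedBall (0 : E) L := mem_closedBall_self hL.le
  have hcomp := isCompact_closedBall (0 : E) L
  have hcont : ContinuousOn ξ (closedBall (0 : E) L) := h.continuousOn.mono hball
  obtain ⟨μ, hμ, hμξ⟩ := hcomp.exists_forall_le' hcont (fun y hy => h.pos y (hball hy))
  obtain ⟨z, -, hz⟩ := hcomp.exists_isMaxOn ⟨0, h0L⟩ hcont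
  have hμz : μ ≤ ξ z := (hμξ 0 h0L).trans (hz h0L)
  have hz0 : 0 < ξ z := hμ.trans_le hμz
  have hc0 : ContinuousAt (fun y => ξ y - ⟪p y, y⟫) 0 := by
    have h1 := (h.hasFDerivAt 0 (hball h0L)).continuousAt
    have h2 := (h.hasFDerivAt_grad 0 (hball h0L)).continuousAt
    fun_prop
  have hev : ∀ᶠ y in 𝓝 (0 : E), 0 < ξ y - ⟪p y, y⟫ :=
    hc0.tendsto.eventually_const_lt (by simpa using h.pos 0 (hball h0L))
  obtain ⟨r, hr, hrp⟩ := Metric.nhds_basis_closedBall.eventually_iff.1 hev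
  -- No failure occurs for ‖y‖ ≤ r. Beyond r, a failure forces τ ≥ min ξ / max ξ, up to the lower
  -- bound μ for the minimum.
  refine ⟨μ / ξ z * r ^ 2, by positivity, fun τ y hτ hτ1 hy hfail => ?_⟩
  rcases le_or_gt ‖y‖ r with hyr | hyr
  · obtain ⟨t, ht, htle⟩ := hfail.exists_le_inner hτ (fun t ht => h.hasFDerivAt _
      (hball (smul_mem_closedBall_zero hy (hτ.le.trans ht.1) ht.2)))
    have := hrp (smul_mem_closedBall_zero hyr (hτ.le.trans ht.1) ht.2)
    linarith
  · have hτμ : μ / ξ z ≤ τ := by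
      rw [div_le_iff₀ hz0]
      rcases hfail with ⟨h1, h2⟩ | ⟨h1, -⟩
      · have h3 := hμξ _ (smul_mem_closedBall_zero hy hτ.le hτ1)
        have h4 : ξ y ≤ ξ z := hz (mem_closedBall_zero_iff.2 hy)
        calc μ ≤ τ * ξ y := h3.trans h2
          _ ≤ τ * ξ z := by gcongr
      · rw [h1, one_mul]; exact hμz
    gcongr

/-- A Kelvin transform lying above the solution outside of its sphere, and strictly above it
on an outer sphere, cannot touch it. -/
theorem IsConformalSolution.not_kelvin_touches (h𝓛 : EllipticLevelSet 𝓛) (hO : IsOpen O)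
    (h : IsConformalSolution 𝓛 O ξ p X) {L κ : ℝ} (hκ : 0 < κ)
    (hball : closedBall (0 : E) L ⊆ O)
    (hle : ∀ y, κ ≤ ‖y‖ ^ 2 → ‖y‖ ≤ L → ξ y ≤ kelvin κ ξ y)
    (hlt : ∀ y, ‖y‖ = L → ξ y < kelvin κ ξ y) {y₀ : E} (hy₀ : κ ≤ ‖y₀‖ ^ 2) (hy₀L : ‖y₀‖ ≤ L)
    (heq : ξ y₀ = kelvin κ ξ y₀) (hder : ‖y₀‖ ^ 2 = κ → ξ y₀ ≤ ⟪p y₀, y₀⟫) : False := by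
  have hk := h.kelvin_transform h𝓛 hκ
  have hne : ∀ y : E, κ ≤ ‖y‖ ^ 2 → y ≠ 0 := by
    rintro y hy rfl
    simp at hy
    linarith
  set O₁ : Set E := {y | y ≠ 0 ∧ sphereInversion κ y ∈ O} with hO₁
  have hO₁open : IsOpen O₁ := by
    have hc : ContinuousOn (sphereInversion κ : E → E) {0}ᶜ := fun y hy =>
      (hasFDerivAt_sphereInversion κ hy).continuousAt.continuousWithinAt
    exact hc.isOpen_inter_preimage isOpen_compl_singleton hO
  have hmem : ∀ y : E, κ ≤ ‖y‖ ^ 2 → ‖y‖ ≤ L → y ∈ O ∩ O₁ := by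
    intro y hy hyL
    have hy0 := norm_pos_iff.2 (hne y hy)
    refine ⟨hball (mem_closedBall_zero_iff.2 hyL), hne y hy, hball ?_⟩
    rw [mem_closedBall_zero_iff, norm_sphereInversion hκ, ← div_eq_mul_inv, div_le_iff₀ hy0]
    nlinarith
  set K : Set E := {y | κ ≤ ‖y‖ ^ 2} ∩ closedBall 0 L with hK
  have hKc : IsCompact K := by
    apply (isCompact_closedBall (0 : E) L).inter_left
    exact isClosed_le continuous_const (by fun_prop)
  have hKmem : ∀ y ∈ K, y ∈ O ∩ O₁ := fun y hy => hmem y hy.1 (mem_closedBall_zero_iff.1 hy.2)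
  have hcont : ContinuousOn (fun y => kelvin κ ξ y - ξ y) K :=
    (hk.continuousOn.mono fun y hy => (hKmem y hy).2).sub
      (h.continuousOn.mono fun y hy => (hKmem y hy).1)
  have hZ : IsCompact (K ∩ (fun y => kelvin κ ξ y - ξ y) ⁻¹' {0}) :=
    hKc.of_isClosed_subset
      (hcont.preimage_isClosed_of_isClosed hKc.isClosed isClosed_singleton) Set.inter_subset_left
  have hy₀Z : y₀ ∈ K ∩ (fun y => kelvin κ ξ y - ξ y) ⁻¹' {0} :=
    ⟨⟨hy₀, mem_closedBall_zero_iff.2 hy₀L⟩, sub_eq_zero.2 heq.symm⟩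
  -- Past a contact point of maximal norm the inequality is strict. This gives the touching ball for
  -- the Hopf lemma without a connectedness argument.
  obtain ⟨z₁, hz₁, hz₁max⟩ := hZ.exists_isMaxOn ⟨y₀, hy₀Z⟩ continuous_norm.continuousOn
  have hLt : ∀ z ∈ K ∩ (fun y => kelvin κ ξ y - ξ y) ⁻¹' {0}, ‖z‖ < L := by
    intro z hz
    refine lt_of_le_of_ne (mem_closedBall_zero_iff.1 hz.1.2) fun hzL => ?_
    exact (hlt z hzL).ne (sub_eq_zero.1 hz.2).symm
  obtain ⟨z, hz, hzmax, hzder⟩ : ∃ z ∈ K ∩ (fun y => kelvin κ ξ y - ξ y) ⁻¹' {0},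
      (∀ w ∈ K ∩ (fun y => kelvin κ ξ y - ξ y) ⁻¹' {0}, ‖w‖ ≤ ‖z‖) ∧
        ⟪kelvinGrad κ ξ p z - p z, z⟫ ≤ 0 := by
    rcases (show κ ≤ ‖z₁‖ ^ 2 from hz₁.1.1).lt_or_eq with hlt₁ | heq₁
    · refine ⟨z₁, hz₁, fun w hw => hz₁max hw, ?_⟩
      have hmin : IsLocalMin (fun y => kelvin κ ξ y - ξ y) z₁ := by
        have e1 : ∀ᶠ y : E in 𝓝 z₁, κ < ‖y‖ ^ 2 :=
          (by fun_prop : Continuous fun y : E => ‖y‖ ^ 2).continuousAt.tendsto.eventually_const_lt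
            hlt₁
        have e2 : ∀ᶠ y : E in 𝓝 z₁, ‖y‖ < L :=
          continuous_norm.continuousAt.tendsto.eventually_lt_const (hLt z₁ hz₁)
        filter_upwards [e1, e2] with y h1 h2
        have h3 : kelvin κ ξ z₁ - ξ z₁ = 0 := hz₁.2
        rw [h3]
        linarith [hle y h1.le h2.le]
      have := ((hk.hasHessianAt hO₁open (hKmem _ hz₁.1).2).sub
        (h.hasHessianAt hO (hKmem _ hz₁.1).1)).eq_zero_of_isLocalMin hmin
      rw [this, inner_zero_left]
    · have hn : ‖y₀‖ ^ 2 = κ := by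
        apply le_antisymm _ hy₀
        have : ‖y₀‖ ≤ ‖z₁‖ := hz₁max hy₀Z
        rw [heq₁]
        gcongr
      have hn' : ‖y₀‖ = ‖z₁‖ := by
        rw [heq₁] at hn
        exact (sq_eq_sq₀ (norm_nonneg _) (norm_nonneg _)).1 hn
      refine ⟨y₀, hy₀Z, fun w hw => hn' ▸ hz₁max hw, ?_⟩
      have hinv : sphereInversion κ y₀ = y₀ := by
        rw [sphereInversion, hn, mul_inv_cancel₀ hκ.ne', one_smul]
      have := hder hn
      have e : ⟪kelvinGrad κ ξ p y₀ - p y₀, y₀⟫ = 2 * (ξ y₀ - ⟪p y₀, y₀⟫) := by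
        rw [kelvinGrad, hinv, inner_sub_left, inner_add_left, inner_smul_left,
          hyperplaneReflection_apply, inner_sub_left, inner_smul_left, real_inner_self_eq_norm_sq,
          hn, real_inner_comm y₀]
        simp only [conj_trivial]
        field_simp
        ring
      rw [e]
      linarith
  have hz0 : 0 < ‖z‖ := norm_pos_iff.2 (hne z hz.1.1)
  -- The ball about (1 + θ)z of radius θ‖z‖ is tangent at z to the sphere ‖y‖ = ‖z‖ from outside and
  -- reaches exactly out to ‖y‖ = L.
  set θ := (L - ‖z‖) / (2 * ‖z‖) with hθ
  have hθ0 : 0 < θ := div_pos (sub_pos.2 (hLt z hz)) (by positivity)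
  have hθL : (1 + 2 * θ) * ‖z‖ = L := by rw [hθ]; field_simp; ring
  have hsub : z - (1 + θ) • z = (-θ) • z := by module
  have hdist : dist z ((1 + θ) • z) = θ * ‖z‖ := by
    rw [dist_eq_norm, hsub, norm_smul, norm_neg, Real.norm_eq_abs, abs_of_pos hθ0]
  refine IsConformalSolution.hopf h𝓛 (hO.inter hO₁open) (h.mono Set.inter_subset_left)
    (hk.mono Set.inter_subset_right) (x := z) (c := (1 + θ) • z) (hKmem z hz.1) ?_ ?_ ?_ ?_
  · intro heqz
    rw [← heqz, dist_self] at hdist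
    have : 0 < θ * ‖z‖ := by positivity
    linarith
  · exact (sub_eq_zero.1 hz.2).symm
  · intro y hy hyz
    rw [mem_closedBall, hdist, dist_eq_norm] at hy
    have hyL : ‖y‖ ≤ L := by
      calc ‖y‖ = ‖(y - (1 + θ) • z) + (1 + θ) • z‖ := by rw [sub_add_cancel]
        _ ≤ ‖y - (1 + θ) • z‖ + ‖(1 + θ) • z‖ := norm_add_le _ _
        _ ≤ θ * ‖z‖ + (1 + θ) * ‖z‖ := by
          rw [norm_smul, Real.norm_eq_abs, abs_of_pos (by linarith)]
          gcongr
        _ = L := by rw [← hθL]; ring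
    have hylt : ‖z‖ < ‖y‖ := by
      by_contra! hcon
      apply hyz
      have h1 : ‖y - (1 + θ) • z‖ ^ 2 ≤ (θ * ‖z‖) ^ 2 := by gcongr
      rw [norm_sub_sq_real, inner_smul_right, norm_smul, Real.norm_eq_abs,
        abs_of_pos (by linarith)] at h1
      have h2 : ‖y - z‖ ^ 2 = ‖y‖ ^ 2 - 2 * ⟪y, z⟫ + ‖z‖ ^ 2 := norm_sub_sq_real y z
      have h3 : ‖y‖ ^ 2 ≤ ‖z‖ ^ 2 := by gcongr
      have h4 : (1 + θ) * ‖y - z‖ ^ 2 ≤ 0 := by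
        rw [h2]
        nlinarith
      have h5 : ‖y - z‖ ^ 2 ≤ 0 := by
        by_contra! h6
        have : 0 < (1 + θ) * ‖y - z‖ ^ 2 := by positivity
        linarith
      have h6 : ‖y - z‖ = 0 := by
        have := sq_nonneg ‖y - z‖
        exact pow_eq_zero_iff (two_ne_zero) |>.1 (le_antisymm h5 this)
      exact sub_eq_zero.1 (norm_eq_zero.1 h6)
    have hyκ : κ ≤ ‖y‖ ^ 2 := (show κ ≤ ‖z‖ ^ 2 from hz.1.1).trans (by gcongr)
    refine ⟨hmem y hyκ hyL, lt_of_le_of_ne (hle y hyκ hyL) fun hcon => ?_⟩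
    exact absurd (hzmax y ⟨⟨hyκ, mem_closedBall_zero_iff.2 hyL⟩, sub_eq_zero.2 hcon.symm⟩)
      (not_le.2 hylt)
  · have : (1 + θ) • z - z = θ • z := by module
    rw [this, inner_smul_right]
    exact mul_nonpos_of_nonneg_of_nonpos hθ0.le hzder

/-- The method of moving spheres. -/
theorem IsConformalSolution.moving_spheres (h𝓛 : EllipticLevelSet 𝓛) (hO : IsOpen O)
    (h : IsConformalSolution 𝓛 O ξ p X) {L r μ S : ℝ} (hr : 0 < r) (hrL : r < L)
    (hball : closedBall (0 : E) L ⊆ O) (hμ : ∀ y, ‖y‖ ≤ r → μ ≤ ξ y)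
    (hS : ∀ y, ‖y‖ = L → ξ y ≤ S) (hout : r ^ 2 * S < μ * L ^ 2) {τ : ℝ} {y : E} (hτ0 : 0 < τ)
    (hτ1 : τ < 1) (hy : ‖y‖ ≤ L) (hτy : τ * ‖y‖ ^ 2 ≤ r ^ 2) : τ * ξ y < ξ (τ • y) := by
  have hL : 0 < L := hr.trans hrL
  by_contra! hcon
  obtain ⟨ε, hε, hεle⟩ := h.exists_le_of_failsDecrease hL hball
  -- The sphere of squared radius κ = τ‖y‖² inverts y to τy, and for τ < 1 failure says that the
  -- Kelvin transform is at most ξ at y. Minimising κ over B finds the critical sphere; the bound ε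
  -- keeps τ away from 0 and B compact.
  set B : Set (ℝ × E) := {x | (0 ≤ x.1 ∧ x.1 ≤ 1 ∧ ‖x.2‖ ≤ L ∧ ε ≤ x.1 * ‖x.2‖ ^ 2 ∧
    x.1 * ‖x.2‖ ^ 2 ≤ r ^ 2) ∧ FailsDecrease ξ p x.1 x.2} with hB
  have hpos : ∀ x ∈ B, 0 < x.1 := by
    rintro x ⟨⟨h1, -, -, h2, -⟩, -⟩
    refine lt_of_le_of_ne h1 fun h0 => ?_
    rw [← h0, zero_mul] at h2
    linarith
  have hBc : IsCompact B := by
    apply ((isCompact_Icc (a := (0 : ℝ)) (b := 1)).prod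
      (isCompact_closedBall (0 : E) L)).of_isClosed_subset
    · apply IsSeqClosed.isClosed
      intro x x' hx hx'
      have h1 : Tendsto (fun k => (x k).1) atTop (𝓝 x'.1) := (continuous_fst.tendsto x').comp hx'
      have h2 : Tendsto (fun k => (x k).2) atTop (𝓝 x'.2) := (continuous_snd.tendsto x').comp hx'
      have h3 := h1.mul (h2.norm.pow 2)
      refine ⟨⟨ge_of_tendsto' h1 fun k => (hx k).1.1, le_of_tendsto' h1 fun k => (hx k).1.2.1,
        le_of_tendsto' h2.norm fun k => (hx k).1.2.2.1,
        ge_of_tendsto' h3 fun k => (hx k).1.2.2.2.1,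
        le_of_tendsto' h3 fun k => (hx k).1.2.2.2.2⟩, ?_⟩
      exact h.failsDecrease_of_tendsto hball h1 h2 (fun k => hpos _ (hx k))
        (fun k => (hx k).1.2.1) (fun k => (hx k).1.2.2.1) (fun k => (hx k).2)
    · rintro x ⟨⟨h1, h2, h3, -⟩, -⟩
      exact ⟨⟨h1, h2⟩, mem_closedBall_zero_iff.2 h3⟩
  have hfail : FailsDecrease ξ p τ y := Or.inl ⟨hτ1, hcon⟩
  have hτyB : (τ, y) ∈ B := ⟨⟨hτ0.le, hτ1.le, hy, hεle τ y hτ0 hτ1.le hy hfail, hτy⟩, hfail⟩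
  obtain ⟨⟨τ₀, y₀⟩, hmemB, hminB⟩ := hBc.exists_isMinOn ⟨_, hτyB⟩
    (f := fun x : ℝ × E => x.1 * ‖x.2‖ ^ 2) (by fun_prop)
  have hτ₀ := hpos _ hmemB
  obtain ⟨⟨-, hτ₀1, hy₀L, hεκ, hκr⟩, hfail₀⟩ := hmemB
  simp only at hτ₀ hτ₀1 hy₀L hεκ hκr hfail₀
  set κ := τ₀ * ‖y₀‖ ^ 2 with hκ
  have hκ0 : 0 < κ := hε.trans_le hεκ
  have hkel : ∀ z : E, z ≠ 0 → kelvin κ ξ z = (κ / ‖z‖ ^ 2)⁻¹ * ξ ((κ / ‖z‖ ^ 2) • z) := by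
    intro z hz
    rw [kelvin, sphereInversion, inv_div, ← div_eq_mul_inv κ, div_eq_inv_mul (‖z‖ ^ 2)]
  have hgood : ∀ (t : ℝ) (z : E), 0 < t → t < 1 → ‖z‖ ≤ L → t * ‖z‖ ^ 2 < κ →
      t * ξ z < ξ (t • z) := by
    intro t z ht0 ht1 hz htz
    by_contra! hc
    have hf : FailsDecrease ξ p t z := Or.inl ⟨ht1, hc⟩
    have : (t, z) ∈ B :=
      ⟨⟨ht0.le, ht1.le, hz, hεle t z ht0 ht1.le hz hf, htz.le.trans hκr⟩, hf⟩
    exact absurd (hminB this) (not_le.2 htz)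
  have hweak : ∀ (t : ℝ) (z : E), 0 < t → t < 1 → ‖z‖ ≤ L → t * ‖z‖ ^ 2 = κ →
      t * ξ z ≤ ξ (t • z) := by
    intro t z ht0 ht1 hz htz
    have hzO : t • z ∈ O := hball (smul_mem_closedBall_zero hz ht0.le ht1.le)
    have h1 : Tendsto (fun s : ℝ => ξ (s • z)) (𝓝[<] t) (𝓝 (ξ (t • z))) := by
      have : ContinuousAt (fun s : ℝ => ξ (s • z)) t :=
        (h.hasFDerivAt _ hzO).continuousAt.comp (f := fun s : ℝ => s • z) (by fun_prop)
      exact this.tendsto.mono_left nhdsWithin_le_nhds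
    have h2 : Tendsto (fun s : ℝ => s * ξ z) (𝓝[<] t) (𝓝 (t * ξ z)) := by
      have : Continuous (fun s : ℝ => s * ξ z) := by fun_prop
      exact (this.tendsto t).mono_left nhdsWithin_le_nhds
    apply le_of_tendsto_of_tendsto h2 h1
    filter_upwards [self_mem_nhdsWithin,
      (eventually_gt_nhds ht0).filter_mono nhdsWithin_le_nhds] with s hs hs0
    have hs : s < t := hs
    refine (hgood s z hs0 (hs.trans ht1) hz ?_).le
    have hz2 : 0 < ‖z‖ ^ 2 := by
      by_contra! hc
      nlinarith
    rw [← htz]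
    gcongr
  have hy₀0 : 0 < ‖y₀‖ ^ 2 := by
    by_contra! hc
    nlinarith
  have hκy₀ : κ ≤ ‖y₀‖ ^ 2 := by rw [hκ]; nlinarith
  have hτκ : κ / ‖y₀‖ ^ 2 = τ₀ := by rw [hκ]; exact mul_div_cancel_right₀ _ hy₀0.ne'
  have hκL : κ < L ^ 2 := hκr.trans_lt (by gcongr)
  have hne : ∀ z : E, κ ≤ ‖z‖ ^ 2 → z ≠ 0 := by
    rintro z hz rfl
    simp at hz
    linarith
  have hle : ∀ z, κ ≤ ‖z‖ ^ 2 → ‖z‖ ≤ L → ξ z ≤ kelvin κ ξ z := by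
    intro z hz hzL
    have hz0 : 0 < ‖z‖ ^ 2 := hκ0.trans_le hz
    rw [hkel z (hne z hz)]
    rcases hz.lt_or_eq with hlt | heq
    · have := hweak (κ / ‖z‖ ^ 2) z (by positivity) ((div_lt_one hz0).2 hlt) hzL
        (div_mul_cancel₀ _ hz0.ne')
      rwa [← div_eq_inv_mul, le_div_iff₀ (by positivity), mul_comm]
    · rw [← heq, div_self hκ0.ne', inv_one, one_mul, one_smul]
  refine h.not_kelvin_touches h𝓛 hO hκ0 hball hle ?_ hκy₀ hy₀L ?_ ?_
  · intro z hz
    -- On ‖z‖ = L the inverted point lies in the ball of radius r, so the transform is at least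
    -- μL²/κ, which exceeds S by `hout`.
    have hz0 : κ ≤ ‖z‖ ^ 2 := by rw [hz]; exact hκL.le
    have hn : ‖(κ / L ^ 2) • z‖ ≤ r := by
      rw [norm_smul, hz, Real.norm_eq_abs, abs_of_pos (by positivity)]
      have : κ / L ^ 2 * L = κ / L := by field_simp
      rw [this, div_le_iff₀ hL]
      nlinarith
    have h1 := hμ _ hn
    rw [hkel z (hne z hz0), hz, ← div_eq_inv_mul, lt_div_iff₀ (by positivity)]
    have h2 := hS z hz
    have h3 : 0 < ξ z := h.pos z (hball (mem_closedBall_zero_iff.2 hz.le))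
    have h5 : 0 ≤ S := h3.le.trans h2
    have h4 : ξ z * (κ / L ^ 2) < μ := by
      rw [mul_div_assoc', div_lt_iff₀ (by positivity)]
      calc ξ z * κ ≤ S * r ^ 2 := by gcongr
        _ < μ * L ^ 2 := by linarith
    linarith
  · have hzz : y₀ ≠ 0 := hne _ hκy₀
    rw [hkel y₀ hzz, hτκ]
    rcases hτ₀1.lt_or_eq with h1 | h1
    · have h2 := hweak τ₀ y₀ hτ₀ h1 hy₀L rfl
      rcases hfail₀ with h3 | h3
      · have : ξ (τ₀ • y₀) = τ₀ * ξ y₀ := le_antisymm h3.2 h2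
        rw [this]
        field_simp
      · exact absurd h3.1 h1.ne
    · rw [h1, inv_one, one_mul, one_smul]
  · intro hn
    have h1 : τ₀ = 1 := by rw [← hτκ, hn, div_self hκ0.ne']
    rcases hfail₀ with h3 | h3
    · exact absurd h1 h3.1.ne
    · exact h3.2

end MovingSpheres

/-! ### From smallness of ξ(x₀)·S to an almost nonpositive conformal Hessian. -/

section Harnack

variable {E : Type*} [NormedAddCommGroup E] [InnerProductSpace ℝ E] [FiniteDimensional ℝ E]

/-- Selection of a point near which a positive function is controlled from below. -/
theorem exists_point_selection {ξ : E → ℝ} {x₀ : E} {ρ : ℝ} (hρ : 0 < ρ)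
    (hc : ContinuousOn ξ (closedBall x₀ ρ)) (hpos : ∀ x ∈ closedBall x₀ ρ, 0 < ξ x) :
    ∃ (x : E) (σ : ℝ), 0 < σ ∧ dist x x₀ + 2 * σ = ρ ∧ ξ x * ρ ≤ 2 * σ * ξ x₀ ∧
      ∀ y ∈ closedBall x σ, ξ x ≤ 2 * ξ y := by
  have hx₀ : x₀ ∈ closedBall x₀ ρ := mem_closedBall_self hρ.le
  -- The weight ρ - dist keeps the maximum off the boundary and changes by at most a factor 2
  -- towards the boundary within half the remaining distance.
  obtain ⟨x, hx, hmax⟩ := (isCompact_closedBall x₀ ρ).exists_isMaxOn ⟨x₀, hx₀⟩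
    (f := fun x => (ρ - dist x x₀) / ξ x)
    (ContinuousOn.div (by fun_prop) hc fun y hy => (hpos y hy).ne')
  have hξx := hpos x hx
  have hξx₀ := hpos x₀ hx₀
  have h1 : ρ / ξ x₀ ≤ (ρ - dist x x₀) / ξ x := by simpa using hmax hx₀
  rw [div_le_div_iff₀ hξx₀ hξx] at h1
  have hσ : 0 < ρ - dist x x₀ := by
    by_contra! hc
    have : 0 < ρ * ξ x := by positivity
    nlinarith
  refine ⟨x, (ρ - dist x x₀) / 2, by linarith, by ring, by linarith, fun y hy => ?_⟩
  have hy' : dist y x ≤ (ρ - dist x x₀) / 2 := hy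
  have htri := dist_triangle y x x₀
  have hyρ : y ∈ closedBall x₀ ρ := by
    rw [mem_closedBall]
    linarith
  have hξy := hpos y hyρ
  have h2 : (ρ - dist y x₀) / ξ y ≤ (ρ - dist x x₀) / ξ x := hmax hyρ
  rw [div_le_div_iff₀ hξy hξx] at h2
  have h3 : (ρ - dist x x₀) / 2 * ξ x ≤ (ρ - dist x x₀) * ξ y :=
    le_trans (by gcongr; linarith) h2
  have h4 : (ρ - dist x x₀) * ξ x ≤ (ρ - dist x x₀) * (2 * ξ y) := by linarith
  exact le_of_mul_le_mul_left h4 hσ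

variable {𝓛 : Set (E →L[ℝ] E)} {ξ : E → ℝ} {p : E → E} {X : E → E →L[ℝ] E}

/-- The upper bound near a selected point, by moving spheres. -/
theorem IsConformalSolution.le_two_mul (h𝓛 : EllipticLevelSet 𝓛) {R S : ℝ} (hR : 0 < R)
    (h : IsConformalSolution 𝓛 (ball 0 (3 * R)) ξ p X) (hS : ∀ x ∈ ball (0 : E) (2 * R), ξ x ≤ S)
    {x₁ : E} {σ d : ℝ} (hd : 0 < d) (hdσ : 3 * d ≤ σ) (hx₁ : ‖x₁‖ + 2 * σ < 3 / 2 * R)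
    (hσR : 4 * σ ≤ R) (hσ : ∀ y ∈ closedBall x₁ σ, ξ x₁ ≤ 2 * ξ y)
    (hdS : 64 * d ^ 2 * S ≤ R ^ 2 * ξ x₁) {y : E} (hy : y ∈ closedBall x₁ d) :
    ξ y ≤ 2 * ξ x₁ := by
  have hx₁pos : 0 < ξ x₁ := by
    apply h.pos
    rw [mem_ball_zero_iff]
    linarith
  rcases eq_or_ne y x₁ with rfl | hne
  · linarith
  set s := ‖y - x₁‖ with hs
  have hs0 : 0 < s := norm_pos_iff.2 (sub_ne_zero.2 hne)
  have hsd : s ≤ d := by rw [hs, ← dist_eq_norm]; exact hy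
  -- With a on the far side of x₁ at distance d, inversion about a with κ = d(d + s) sends y to x₁.
  -- Moving spheres give ξ(y) < ((d + s)/d) ξ(x₁), and s ≤ d.
  set a := x₁ - (d / s) • (y - x₁) with ha
  have hax : ‖a - x₁‖ = d := by
    rw [ha, sub_sub_cancel_left, norm_neg, norm_smul, Real.norm_eq_abs, abs_of_pos (by positivity),
      ← hs]
    field_simp
  have hya : ‖y - a‖ = d + s := by
    have : y - a = (1 + d / s) • (y - x₁) := by rw [ha]; module
    rw [this, norm_smul, Real.norm_eq_abs, abs_of_pos (by positivity), ← hs]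
    field_simp
    ring
  have hmid : a + (d / (d + s)) • (y - a) = x₁ := by
    have : y - a = (1 + d / s) • (y - x₁) := by rw [ha]; module
    rw [this, ha, smul_smul]
    have : d / (d + s) * (1 + d / s) = d / s := by field_simp; ring
    rw [this]
    abel
  have hnear : ∀ w : E, ‖w‖ ≤ R / 2 → ‖a + w‖ < 2 * R := by
    intro w hw
    have : a + w = x₁ + (a - x₁) + w := by abel
    calc ‖a + w‖ ≤ ‖x₁‖ + ‖a - x₁‖ + ‖w‖ := by rw [this]; exact norm_add₃_le
      _ < 2 * R := by rw [hax]; linarith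
  have hsol := h.translate a
  have key := hsol.moving_spheres h𝓛 (isOpen_ball.preimage (by fun_prop : Continuous (a + ·)))
    (L := R / 2) (r := 2 * d) (μ := ξ x₁ / 2) (S := S) (τ := d / (d + s)) (y := y - a)
    (by positivity) (by linarith) ?_ ?_ ?_ ?_ (by positivity)
    ((div_lt_one (by positivity)).2 (by linarith)) (by rw [hya]; linarith) ?_
  · rw [hmid, add_sub_cancel, div_mul_eq_mul_div, div_lt_iff₀ (by positivity)] at key
    have h1 : d * ξ y ≤ d * (2 * ξ x₁) := by nlinarith
    exact le_of_mul_le_mul_left h1 hd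
  · intro w hw
    have := hnear w (mem_closedBall_zero_iff.1 hw)
    change a + w ∈ ball 0 (3 * R)
    rw [mem_ball_zero_iff]
    linarith
  · intro w hw
    have : a + w ∈ closedBall x₁ σ := by
      rw [mem_closedBall, dist_eq_norm]
      have e : a + w - x₁ = (a - x₁) + w := by abel
      rw [e]
      refine (norm_add_le _ _).trans ?_
      rw [hax]
      linarith
    linarith [hσ _ this]
  · intro w hw
    exact hS _ (mem_ball_zero_iff.2 (hnear w hw.le))
  · have : 0 < R ^ 2 * ξ x₁ := by positivity
    nlinarith
  · rw [hya]
    have : d / (d + s) * (d + s) ^ 2 = d * (d + s) := by field_simp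
    rw [this]
    nlinarith

/-- If `ξ x₀ * sup ξ` is small then the conformal Hessian of `ξ` is almost nonpositive at some
point. -/
theorem IsConformalSolution.exists_jetHessian_le (h𝓛 : EllipticLevelSet 𝓛) {R S : ℝ} (hR : 0 < R)
    (h : IsConformalSolution 𝓛 (ball 0 (3 * R)) ξ p X) (hS : ∀ x ∈ ball (0 : E) (2 * R), ξ x ≤ S)
    {x₀ : E} (hx₀ : x₀ ∈ ball (0 : E) R) :
    ∃ z ∈ ball (0 : E) (3 * R), ∀ v,
      ⟪jetHessian (ξ z) (p z) (X z) v, v⟫ ≤ 1152 * (ξ x₀ * S) / R ^ 2 * ‖v‖ ^ 2 := by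
  rw [mem_ball_zero_iff] at hx₀
  have hsub : closedBall x₀ (R / 2) ⊆ ball (0 : E) (3 * R) := by
    intro y hy
    rw [mem_closedBall, dist_eq_norm] at hy
    rw [mem_ball_zero_iff]
    have := norm_le_norm_add_norm_sub' y x₀
    linarith
  obtain ⟨x₁, σ, hσ, hσd, hle, hball⟩ := exists_point_selection (ξ := ξ) (x₀ := x₀) (half_pos hR)
    (h.continuousOn.mono hsub) (fun x hx => h.pos x (hsub hx))
  have hx₁norm : ‖x₁‖ + 2 * σ < 3 / 2 * R := by
    have := norm_le_norm_add_norm_sub' x₁ x₀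
    rw [← dist_eq_norm] at this
    linarith
  have hσR : 4 * σ ≤ R := by linarith [dist_nonneg (x := x₁) (y := x₀)]
  have hξ₀ : 0 < ξ x₀ := h.pos _ (hsub (mem_closedBall_self (by linarith)))
  have hS₀ : ξ x₀ ≤ S := hS x₀ (mem_ball_zero_iff.2 (by linarith))
  have hS0 : 0 < S := hξ₀.trans_le hS₀
  set m := ξ x₁ with hm
  have hm0 : 0 < m := h.pos _ (mem_ball_zero_iff.2 (by linarith))
  have hmξ : m ≤ ξ x₀ := by
    have : m * (R / 2) ≤ ξ x₀ * (R / 2) := by nlinarith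
    exact le_of_mul_le_mul_right this (by linarith)
  -- Here d is the smaller of σ/3 and the scale with 64d²S = R²m. In the first case mR ≤ 4σξ(x₀)
  -- gives 144 = 16·9; in the second, 144/64 = 9/4 and m ≤ ξ(x₀) suffice.
  obtain ⟨d, hd, hd3, hdS, hmd⟩ : ∃ d, 0 < d ∧ 3 * d ≤ σ ∧ 64 * d ^ 2 * S ≤ R ^ 2 * m ∧
      m ^ 2 * R ^ 2 ≤ 144 * (ξ x₀ * S) * d ^ 2 := by
    rcases le_total (64 * (σ / 3) ^ 2 * S) (R ^ 2 * m) with hcase | hcase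
    · refine ⟨σ / 3, by positivity, by linarith, hcase, ?_⟩
      have h1 : (m * R) ^ 2 ≤ (4 * σ * ξ x₀) ^ 2 := by
        have : m * R ≤ 4 * σ * ξ x₀ := by linarith
        gcongr
      have h2 : ξ x₀ * ξ x₀ * σ ^ 2 ≤ ξ x₀ * S * σ ^ 2 := by gcongr
      nlinarith
    · have hq : 0 < R ^ 2 * m / (64 * S) := by positivity
      have hsq : Real.sqrt (R ^ 2 * m / (64 * S)) ^ 2 = R ^ 2 * m / (64 * S) :=
        Real.sq_sqrt hq.le
      refine ⟨Real.sqrt (R ^ 2 * m / (64 * S)), Real.sqrt_pos.2 hq, ?_, ?_, ?_⟩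
      · have : Real.sqrt (R ^ 2 * m / (64 * S)) ≤ σ / 3 := by
          rw [Real.sqrt_le_left (by positivity), div_le_iff₀ (by positivity)]
          linarith
        linarith
      · rw [hsq]
        apply le_of_eq
        field_simp
      · rw [hsq]
        have : 144 * (ξ x₀ * S) * (R ^ 2 * m / (64 * S)) = 9 / 4 * (ξ x₀ * m * R ^ 2) := by
          field_simp; ring
        rw [this]
        have h2 : m * m * R ^ 2 ≤ ξ x₀ * m * R ^ 2 := by gcongr
        have h3 : 0 < ξ x₀ * m * R ^ 2 := by positivity
        nlinarith
  have hup : ∀ y ∈ closedBall x₁ d, ξ y ≤ 2 * m := fun y hy =>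
    h.le_two_mul h𝓛 hR hS hd hd3 hx₁norm hσR hball hdS hy
  have hsub' : closedBall x₁ d ⊆ ball (0 : E) (3 * R) := by
    intro y hy
    rw [mem_closedBall, dist_eq_norm] at hy
    rw [mem_ball_zero_iff]
    have := norm_le_norm_add_norm_sub' y x₁
    linarith
  -- Then b‖y - x₁‖² - ξ is nonnegative on the boundary of the ball and equals -m at x₁, so its
  -- minimum is interior and there ∇²ξ ≤ 2b.
  set b := 2 * m / d ^ 2 with hb
  have hb0 : 0 < b := by positivity
  have hbd : b * d ^ 2 = 2 * m := by rw [hb]; field_simp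
  set φ : E → ℝ := fun y =>
    (-b) * ((0 ^ 2 - ‖y - x₁‖ ^ 2) + 0 * (0 ^ 2 - ‖y - x₁‖ ^ 2) ^ 2) - ξ y with hφ
  have hφ' : ∀ y, φ y = b * ‖y - x₁‖ ^ 2 - ξ y := fun y => by rw [hφ]; ring
  obtain ⟨z, hz, hmin⟩ := (isCompact_closedBall x₁ d).exists_isMinOn
    ⟨x₁, mem_closedBall_self hd.le⟩ (f := φ)
    (ContinuousOn.sub (by fun_prop) (h.continuousOn.mono hsub'))
  have hzball : z ∈ ball x₁ d := by
    refine lt_of_le_of_ne (mem_closedBall.1 hz) fun heq => ?_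
    have h1 : φ z ≤ φ x₁ := hmin (mem_closedBall_self hd.le)
    rw [dist_eq_norm] at heq
    rw [hφ', hφ', heq, hbd, sub_self, norm_zero] at h1
    have := hup z hz
    simp only [ne_eq, OfNat.ofNat_ne_zero, not_false_eq_true, zero_pow, mul_zero] at h1
    linarith
  have hlmin : IsLocalMin φ z := by
    filter_upwards [isOpen_ball.mem_nhds hzball] with y hy using hmin (ball_subset_closedBall hy)
  have hess := (((hasHessianAt_barrier x₁ 0 0 z).const_mul (-b)).sub
    (h.hasHessianAt isOpen_ball (hsub' hz))).inner_apply_nonneg_of_isLocalMin hlmin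
  refine ⟨z, hsub' hz, fun v => ?_⟩
  have hv := hess v
  simp only [sub_apply, smul_apply, ContinuousLinearMap.id_apply, mul_zero, zero_mul,
    zero_smul, add_zero, inner_sub_left, inner_smul_left, conj_trivial,
    real_inner_self_eq_norm_sq] at hv
  have hξz := h.pos z (hsub' hz)
  have hξz' := hup z hz
  rw [inner_jetHessian]
  have h1 : ξ z * ⟪X z v, v⟫ ≤ ξ z * (2 * b * ‖v‖ ^ 2) := by
    gcongr
    linarith
  have h2 : ξ z * (2 * b * ‖v‖ ^ 2) ≤ 2 * m * (2 * b * ‖v‖ ^ 2) := by gcongr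
  -- The left side is 8m²/d², and 1152 = 8·144.
  have h3 : 2 * m * (2 * b) ≤ 1152 * (ξ x₀ * S) / R ^ 2 := by
    rw [le_div_iff₀ (by positivity), hb]
    have : 2 * m * (2 * (2 * m / d ^ 2)) * R ^ 2 = 8 * (m ^ 2 * R ^ 2) / d ^ 2 := by
      field_simp; ring
    rw [this, div_le_iff₀ (by positivity)]
    linarith
  have h4 : 2 * m * (2 * b) * ‖v‖ ^ 2 ≤ 1152 * (ξ x₀ * S) / R ^ 2 * ‖v‖ ^ 2 := by gcongr
  have h5 : 0 ≤ ‖p z‖ ^ 2 / 2 * ‖v‖ ^ 2 := by positivity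
  linarith

end Harnack

/-! ### Mean value theorem and continuity of the derivative. -/

section MeanValue

variable {V : Type*} [NormedAddCommGroup V] [NormedSpace ℝ V] {F : V → ℝ} {U : Set V}

theorem ContDiffOn.exists_fderiv_eq_sub (hF : ContDiffOn ℝ 1 F U) (hU : IsOpen U) {x y : V}
    (h : segment ℝ x y ⊆ U) : ∃ z ∈ segment ℝ x y, F y - F x = fderiv ℝ F z (y - x) :=
  domain_mvt (f := F) (s := segment ℝ x y) (f' := fderiv ℝ F)
    (fun _ hz => ((hF.differentiableOn one_ne_zero).differentiableAt
      (hU.mem_nhds (h hz))).hasFDerivAt.hasFDerivWithinAt)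
    (convex_segment x y) (left_mem_segment ℝ x y) (right_mem_segment ℝ x y)

theorem ContDiffOn.exists_ball_fderiv_near (hF : ContDiffOn ℝ 1 F U) (hU : IsOpen U) {x : V}
    (hx : x ∈ U) {ε : ℝ} (hε : 0 < ε) : ∃ r > 0, ∀ z ∈ ball x r, z ∈ U ∧
      ∀ v, |fderiv ℝ F z v - fderiv ℝ F x v| ≤ ε * ‖v‖ := by
  have hcont : ContinuousAt (fderiv ℝ F) x :=
    (hF.continuousOn_fderiv_of_isOpen hU le_rfl).continuousAt (hU.mem_nhds hx)
  obtain ⟨r, hr, hrU⟩ := Metric.nhds_basis_ball.eventually_iff.1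
    ((hcont.eventually_mem (ball_mem_nhds (fderiv ℝ F x) hε)).and (hU.mem_nhds hx))
  refine ⟨r, hr, fun z hz => ⟨(hrU hz).2, fun v => ?_⟩⟩
  have h1 : ‖fderiv ℝ F z - fderiv ℝ F x‖ ≤ ε := by
    have := (hrU hz).1
    rw [mem_ball, dist_eq_norm] at this
    exact this.le
  calc |fderiv ℝ F z v - fderiv ℝ F x v| = ‖(fderiv ℝ F z - fderiv ℝ F x) v‖ := rfl
    _ ≤ ‖fderiv ℝ F z - fderiv ℝ F x‖ * ‖v‖ := ContinuousLinearMap.le_opNorm _ _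
    _ ≤ ε * ‖v‖ := by gcongr

end MeanValue

/-! ### The level set of F is elliptic; small symmetric matrices. -/

section Matrices

variable {n : ℕ}

open scoped MatrixOrder in
theorem Matrix.PosSemidef.exists_eq_conjTranspose_mul_self {N : Matrix (Fin n) (Fin n) ℝ}
    (hN : N.PosSemidef) : ∃ B : Matrix (Fin n) (Fin n) ℝ, N = B.conjTranspose * B :=
  CStarAlgebra.nonneg_iff_eq_star_mul_self.mp hN.nonneg

theorem Matrix.PosDef.trace_mul_nonneg {G N : Matrix (Fin n) (Fin n) ℝ} (hG : G.PosDef)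
    (hN : N.PosSemidef) : 0 ≤ (G * N).trace := by
  obtain ⟨B, rfl⟩ := hN.exists_eq_conjTranspose_mul_self
  rw [← Matrix.mul_assoc, Matrix.trace_mul_comm, ← Matrix.mul_assoc]
  exact (hG.posSemidef.mul_mul_conjTranspose_same B).trace_nonneg

/-- Writing N = BᴴB, the trace is that of the positive semidefinite matrix BGBᴴ, whose diagonal
entries are the values of G on the rows of B. -/
theorem Matrix.PosDef.eq_zero_of_trace_mul_eq_zero {G N : Matrix (Fin n) (Fin n) ℝ}
    (hG : G.PosDef) (hN : N.PosSemidef) (h : (G * N).trace = 0) : N = 0 := by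
  obtain ⟨B, rfl⟩ := hN.exists_eq_conjTranspose_mul_self
  rw [← Matrix.mul_assoc, Matrix.trace_mul_comm, ← Matrix.mul_assoc,
    (hG.posSemidef.mul_mul_conjTranspose_same B).trace_eq_zero_iff] at h
  suffices B = 0 by simp [this]
  refine funext fun i => ?_
  by_contra hB
  have h1 := hG.dotProduct_mulVec_pos (x := B i) hB
  have h2 := congrFun (congrFun h i) i
  rw [Matrix.mul_assoc, Matrix.mul_apply] at h2
  simp only [Matrix.conjTranspose_eq_transpose_of_trivial, Matrix.mul_apply, Matrix.transpose_apply,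
    Matrix.zero_apply] at h2
  simp only [dotProduct, Matrix.mulVec, star_trivial] at h1
  linarith

namespace SymMat

theorem eq_sum_unit (N : SymMat n) : N = ∑ i, ∑ j, N.1 i j • SymMat.unit i j := by
  apply Subtype.ext
  have hN : ∀ i j, N.1 j i = N.1 i j := fun i j => Matrix.IsSymm.apply N.2 i j
  ext k l
  have e : ((∑ i, ∑ j, N.1 i j • SymMat.unit i j : SymMat n) : Matrix (Fin n) (Fin n) ℝ) =
      ∑ i, ∑ j, N.1 i j • (SymMat.unit i j : SymMat n).1 := by
    simp
  rw [e]
  simp only [SymMat.unit, Matrix.sum_apply, Matrix.smul_apply, Matrix.add_apply, Matrix.single_apply,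
    smul_eq_mul, mul_add, Finset.sum_add_distrib, mul_ite, mul_one, mul_zero]
  simp only [ite_and, Finset.sum_ite_eq', Finset.mem_univ, if_true,
    Finset.sum_ite_irrel, Finset.sum_const_zero]
  rw [hN l k]
  ring

theorem fderiv_apply_eq_trace (F : SymMat n → ℝ) (M N : SymMat n) :
    fderiv ℝ F M N = (SymMat.grad F M * N.1).trace := by
  conv_lhs => rw [eq_sum_unit N]
  simp only [map_sum, map_smul, smul_eq_mul, Matrix.trace, Matrix.diag_apply, Matrix.mul_apply,
    SymMat.grad, Matrix.of_apply]
  refine Finset.sum_congr rfl fun i _ => Finset.sum_congr rfl fun j _ => ?_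
  rw [Matrix.IsSymm.apply N.2 i j, mul_comm]

/-- The identity matrix. -/
def one : SymMat n := ⟨1, Matrix.isSymm_one⟩

/-- The matrix `ζ ⊗ ζ`. -/
def rankOne (ζ : EuclideanSpace ℝ (Fin n)) : SymMat n :=
  ⟨Matrix.vecMulVec ζ ζ, by
    change (_ : Matrix (Fin n) (Fin n) ℝ).transpose = _
    rw [Matrix.transpose_vecMulVec]⟩

theorem norm_rankOne_le (ζ : EuclideanSpace ℝ (Fin n)) : ‖rankOne ζ‖ ≤ ‖ζ‖ ^ 2 := by
  change ‖(rankOne ζ).1‖ ≤ _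
  rw [Matrix.norm_le_iff (by positivity)]
  intro i j
  simp only [rankOne, Matrix.vecMulVec_apply, norm_mul, sq]
  have := PiLp.norm_apply_le ζ i
  have := PiLp.norm_apply_le ζ j
  gcongr

theorem trace_mul_rankOne (G : Matrix (Fin n) (Fin n) ℝ) (ζ : EuclideanSpace ℝ (Fin n)) :
    (G * (rankOne ζ).1).trace = ⟪ζ, Matrix.toEuclideanCLM (𝕜 := ℝ) G ζ⟫ := by
  rw [Matrix.inner_toEuclideanCLM, rankOne, Matrix.mul_vecMulVec, Matrix.trace_vecMulVec,
    dotProduct_comm]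

theorem exists_pos_le_of_posDef {G : Matrix (Fin n) (Fin n) ℝ} (hG : G.PosDef) :
    ∃ κ > 0, ∀ ζ : EuclideanSpace ℝ (Fin n),
      κ * ‖ζ‖ ^ 2 ≤ ⟪ζ, Matrix.toEuclideanCLM (𝕜 := ℝ) G ζ⟫ := by
  obtain ⟨κ, hκ, hle⟩ := (isCompact_sphere (0 : EuclideanSpace ℝ (Fin n)) 1).exists_forall_le'
    (f := fun ζ => ⟪ζ, Matrix.toEuclideanCLM (𝕜 := ℝ) G ζ⟫) (a := 0)
    (by fun_prop) (by
      intro ζ hζ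
      rw [Matrix.inner_toEuclideanCLM]
      have h0 : ζ.ofLp ≠ 0 := by
        intro h
        have : ζ = 0 := by ext i; exact congrFun h i
        rw [this] at hζ
        simp at hζ
      simpa using hG.dotProduct_mulVec_pos h0)
  refine ⟨κ, hκ, fun ζ => ?_⟩
  rcases eq_or_ne ζ 0 with rfl | hζ
  · simp
  have hn : 0 < ‖ζ‖ := norm_pos_iff.2 hζ
  have h1 := hle (‖ζ‖⁻¹ • ζ) (by
    rw [mem_sphere_zero_iff_norm, norm_smul, norm_inv, norm_norm, inv_mul_cancel₀ hn.ne'])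
  rw [map_smul, inner_smul_left, inner_smul_right, conj_trivial, ← mul_assoc] at h1
  calc κ * ‖ζ‖ ^ 2 ≤ (‖ζ‖⁻¹ * ‖ζ‖⁻¹ * ⟪ζ, Matrix.toEuclideanCLM (𝕜 := ℝ) G ζ⟫) * ‖ζ‖ ^ 2 := by
        gcongr
    _ = _ := by field_simp

theorem exists_trace_grad_eq_sub {U : Set (SymMat n)} {F : SymMat n → ℝ} (hU : IsOpen U)
    (hF : ContDiffOn ℝ 1 F U) {M M' : SymMat n} (h : segment ℝ M M' ⊆ U) :
    ∃ Z ∈ segment ℝ M M', (SymMat.grad F Z * (M' - M).1).trace = F M' - F M := by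
  obtain ⟨Z, hZ, hZeq⟩ := hF.exists_fderiv_eq_sub hU h
  exact ⟨Z, hZ, (fderiv_apply_eq_trace F Z (M' - M)).symm.trans hZeq.symm⟩

theorem exists_ball_trace_grad_near {U : Set (SymMat n)} {F : SymMat n → ℝ} (hU : IsOpen U)
    (hF : ContDiffOn ℝ 1 F U) {M : SymMat n} (hM : M ∈ U) {ε : ℝ} (hε : 0 < ε) :
    ∃ r > 0, ∀ Z ∈ ball M r, Z ∈ U ∧ ∀ N : SymMat n,
      |(SymMat.grad F Z * N.1).trace - (SymMat.grad F M * N.1).trace| ≤ ε * ‖N‖ := by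
  obtain ⟨r, hr, h⟩ := hF.exists_ball_fderiv_near hU hM hε
  refine ⟨r, hr, fun Z hZ => ⟨(h Z hZ).1, fun N => ?_⟩⟩
  rw [← fderiv_apply_eq_trace, ← fderiv_apply_eq_trace]
  exact (h Z hZ).2 N

/-- A segment with positive semidefinite direction is contained in `U`. -/
theorem segment_subset_of_posSemidef {U : Set (SymMat n)} (hU : IsOpen U)
    (hconv : ∀ M N : SymMat n, N.1.PosDef →
      Convex ℝ (U ∩ {X : SymMat n | ∃ t : ℝ, 0 < t ∧ X = M + t • N}))
    {M M' : SymMat n} (hM : M ∈ U) (hM' : M' ∈ U) (h : (M' - M).1.PosSemidef) :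
    segment ℝ M M' ⊆ U := by
  have hev : ∀ P ∈ U, ∃ r > 0, ∀ t : ℝ, |t| ≤ r → P + t • (one : SymMat n) ∈ U := by
    intro P hP
    have hc : ContinuousAt (fun t : ℝ => P + t • (one : SymMat n)) 0 := by fun_prop
    have := hc.eventually_mem (hU.mem_nhds (by simpa using hP))
    obtain ⟨r, hr, hrU⟩ := Metric.nhds_basis_closedBall.eventually_iff.1 this
    exact ⟨r, hr, fun t ht => hrU (by simpa using ht)⟩
  obtain ⟨r, hr, hrU⟩ := hev M hM
  obtain ⟨r', hr', hrU'⟩ := hev M' hM'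
  obtain ⟨ε, hε, hεr, hεr'⟩ : ∃ ε > 0, ε ≤ r ∧ ε ≤ r' :=
    ⟨min r r', lt_min hr hr', min_le_left _ _, min_le_right _ _⟩
  rw [segment_eq_image]
  rintro _ ⟨s, ⟨hs0, hs1⟩, rfl⟩
  -- The ray hypothesis needs a positive definite direction and t > 0. Shifting the endpoints by -sε
  -- and (1 - s)ε times the identity gives such a direction and leaves the point with parameter s
  -- fixed; P places the shifted endpoints at t = 1 and t = 2.
  set N : SymMat n := (M' - M) + ε • one with hN
  have hNpd : N.1.PosDef := by
    have h1 : (ε • (1 : Matrix (Fin n) (Fin n) ℝ)).PosDef := Matrix.PosDef.one.smul hε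
    exact Matrix.PosDef.posSemidef_add h h1
  set P : SymMat n := M - (s * ε) • one - N with hP
  have h1 : P + (1 : ℝ) • N ∈ U ∩ {X : SymMat n | ∃ t : ℝ, 0 < t ∧ X = P + t • N} := by
    refine ⟨?_, 1, one_pos, rfl⟩
    have : P + (1 : ℝ) • N = M + (-(s * ε)) • one := by rw [hP]; module
    rw [this]
    apply hrU
    rw [abs_neg, abs_of_nonneg (by positivity)]
    nlinarith
  have h2 : P + (2 : ℝ) • N ∈ U ∩ {X : SymMat n | ∃ t : ℝ, 0 < t ∧ X = P + t • N} := by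
    refine ⟨?_, 2, two_pos, rfl⟩
    have : P + (2 : ℝ) • N = M' + ((1 - s) * ε) • one := by rw [hP, hN]; module
    rw [this]
    apply hrU'
    rw [abs_of_nonneg (mul_nonneg (by linarith) hε.le)]
    nlinarith
  have h3 := (hconv P N hNpd) h1 h2 (sub_nonneg.2 hs1) hs0 (by ring)
  have : (1 - s) • M + s • M' = (1 - s) • (P + (1 : ℝ) • N) + s • (P + (2 : ℝ) • N) := by
    rw [hP, hN]; module
  change (1 - s) • M + s • M' ∈ U
  rw [this]
  exact h3.1

theorem posSemidef_of_inner_nonneg (N : SymMat n)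
    (h : ∀ v : EuclideanSpace ℝ (Fin n), 0 ≤ ⟪Matrix.toEuclideanCLM (𝕜 := ℝ) N.1 v, v⟫) :
    N.1.PosSemidef := by
  apply Matrix.PosSemidef.of_dotProduct_mulVec_nonneg
  · change N.1.conjTranspose = N.1
    rw [Matrix.conjTranspose_eq_transpose_of_trivial]
    exact N.2
  · intro x
    have := h (WithLp.toLp 2 x)
    rwa [real_inner_comm, Matrix.inner_toEuclideanCLM] at this

/-- The level set `{M ∈ U | F M = 1}`, as a set of operators. -/
def levelSet (U : Set (SymMat n)) (F : SymMat n → ℝ) :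
    Set (EuclideanSpace ℝ (Fin n) →L[ℝ] EuclideanSpace ℝ (Fin n)) :=
  {A | ∃ M ∈ U, F M = 1 ∧ Matrix.toEuclideanCLM (𝕜 := ℝ) M.1 = A}

/-- For M, M' in the level set, the mean value theorem gives tr(G(M' - M)) = 0 with G = grad F at an
intermediate point. If M ≤ M', positivity of G forces equality. Near M₀, G is bounded and uniformly
positive, so M' - M ≥ a ζ⊗ζ - bI bounds a|ζ|² by a multiple of b. A symmetric involution is
orthogonal, which gives the invariance. -/
theorem ellipticLevelSet {U : Set (SymMat n)} {F : SymMat n → ℝ} (hU : IsOpen U)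
    (hUO : ∀ O : Matrix.orthogonalGroup (Fin n) ℝ, SymMat.conj O '' U = U)
    (hconv : ∀ M N : SymMat n, N.1.PosDef →
      Convex ℝ (U ∩ {X : SymMat n | ∃ t : ℝ, 0 < t ∧ X = M + t • N}))
    (hF : ContDiffOn ℝ 1 F U)
    (hFO : ∀ O : Matrix.orthogonalGroup (Fin n) ℝ, ∀ M ∈ U, F (SymMat.conj O M) = F M)
    (hell : ∀ M ∈ U, (SymMat.grad F M).PosDef) : EllipticLevelSet (levelSet U F) := by
  refine ⟨?_, ?_, ?_⟩
  · rintro _ ⟨M, hM, hFM, rfl⟩ _ ⟨M', hM', hFM', rfl⟩ hle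
    have hpsd : (M' - M).1.PosSemidef := by
      apply posSemidef_of_inner_nonneg
      intro v
      change 0 ≤ ⟪Matrix.toEuclideanCLM (𝕜 := ℝ) (M'.1 - M.1) v, v⟫
      rw [map_sub, sub_apply, inner_sub_left]
      exact sub_nonneg.2 (hle v)
    have hseg := segment_subset_of_posSemidef hU hconv hM hM' hpsd
    obtain ⟨Z, hZ, hZeq⟩ := exists_trace_grad_eq_sub hU hF hseg
    rw [hFM, hFM', sub_self] at hZeq
    have := (hell Z (hseg hZ)).eq_zero_of_trace_mul_eq_zero hpsd hZeq
    have h2 : M'.1 - M.1 = 0 := this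
    rw [sub_eq_zero.1 h2]
  · rintro _ ⟨M₀, hM₀, -, rfl⟩
    obtain ⟨κ, hκ, hκle⟩ := exists_pos_le_of_posDef (hell M₀ hM₀)
    obtain ⟨r, hr, hrU⟩ := exists_ball_trace_grad_near hU hF hM₀ (half_pos hκ)
    set K₁ := |(SymMat.grad F M₀ * (one : SymMat n).1).trace| + κ / 2 * ‖(one : SymMat n)‖ + 1
      with hK₁
    have hK₁pos : 0 < K₁ := by positivity
    refine ⟨2 * K₁ / κ, by positivity,
      (Matrix.toEuclideanCLM (n := Fin n) (𝕜 := ℝ)).symm ⁻¹' ball M₀.1 r, ?_, ?_⟩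
    · have hc : Continuous (Matrix.toEuclideanCLM (n := Fin n) (𝕜 := ℝ)).symm :=
        LinearMap.continuous_of_finiteDimensional
          (Matrix.toEuclideanCLM (n := Fin n) (𝕜 := ℝ)).toAlgEquiv.symm.toLinearMap
      apply hc.continuousAt.preimage_mem_nhds
      rw [StarAlgEquiv.symm_apply_apply]
      exact ball_mem_nhds _ hr
    · rintro _ hA ⟨M, hM, hFM, rfl⟩ _ hB ⟨M', hM', hFM', rfl⟩ a b ζ ha hb hle
      rw [Set.mem_preimage, StarAlgEquiv.symm_apply_apply] at hA hB
      have hA : M ∈ ball M₀ r := hA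
      have hB : M' ∈ ball M₀ r := hB
      have hseg : segment ℝ M M' ⊆ ball M₀ r := (convex_ball M₀ r).segment_subset hA hB
      obtain ⟨Z, hZ, hZeq⟩ := exists_trace_grad_eq_sub hU hF
        (hseg.trans fun Z hZ => (hrU Z hZ).1)
      obtain ⟨hZU, hZd⟩ := hrU Z (hseg hZ)
      rw [hFM, hFM', sub_self] at hZeq
      have hP : (M' - M - a • rankOne ζ + b • one : SymMat n).1.PosSemidef := by
        apply posSemidef_of_inner_nonneg
        intro v
        have h1 := hle v
        change 0 ≤ ⟪Matrix.toEuclideanCLM (𝕜 := ℝ)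
          (M'.1 - M.1 - a • (rankOne ζ).1 + b • (1 : Matrix (Fin n) (Fin n) ℝ)) v, v⟫
        have h2 : ⟪Matrix.toEuclideanCLM (𝕜 := ℝ) (rankOne ζ).1 v, v⟫ = ⟪ζ, v⟫ ^ 2 := by
          rw [real_inner_comm, Matrix.inner_toEuclideanCLM, rankOne, Matrix.vecMulVec_mulVec]
          have e : ⟪ζ, v⟫ = ζ.ofLp ⬝ᵥ v.ofLp := by
            rw [EuclideanSpace.inner_eq_star_dotProduct, star_trivial, dotProduct_comm]
          rw [e]
          simp [dotProduct_comm v.ofLp, sq]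
        rw [map_add, map_sub, map_sub, map_smul, map_smul, map_one]
        simp only [add_apply, sub_apply, smul_apply, one_apply_eq_self,
          inner_add_left, inner_sub_left, inner_smul_left, conj_trivial, h2,
          real_inner_self_eq_norm_sq]
        simp only [sub_apply, inner_sub_left] at h1
        linarith
      have h1 := (hell Z hZU).trace_mul_nonneg hP
      have h1' : (SymMat.grad F Z * (M' - M - a • rankOne ζ + b • one : SymMat n).1).trace =
          (SymMat.grad F Z * (M' - M).1).trace - a * (SymMat.grad F Z * (rankOne ζ).1).trace +
            b * (SymMat.grad F Z * (one : SymMat n).1).trace := by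
        change (SymMat.grad F Z * ((M' - M).1 - a • (rankOne ζ).1 + b • (one : SymMat n).1)).trace = _
        rw [mul_add, mul_sub, Matrix.mul_smul, Matrix.mul_smul, Matrix.trace_add, Matrix.trace_sub,
          Matrix.trace_smul, Matrix.trace_smul, smul_eq_mul, smul_eq_mul]
      rw [h1', hZeq] at h1
      have h2 : κ / 2 * ‖ζ‖ ^ 2 ≤ (SymMat.grad F Z * (rankOne ζ).1).trace := by
        have e1 : κ * ‖ζ‖ ^ 2 ≤ (SymMat.grad F M₀ * (rankOne ζ).1).trace := by
          rw [trace_mul_rankOne]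
          exact hκle ζ
        have e2 : κ / 2 * ‖rankOne ζ‖ ≤ κ / 2 * ‖ζ‖ ^ 2 := by
          gcongr
          exact norm_rankOne_le ζ
        have e3 := (abs_le.1 (hZd (rankOne ζ))).1
        linarith
      have h3 : (SymMat.grad F Z * (one : SymMat n).1).trace ≤ K₁ := by
        have e1 := (abs_le.1 (hZd one)).2
        have e2 := le_abs_self (SymMat.grad F M₀ * (one : SymMat n).1).trace
        rw [hK₁]
        linarith
      have h4 : a * (κ / 2 * ‖ζ‖ ^ 2) ≤ a * (SymMat.grad F Z * (rankOne ζ).1).trace := by gcongr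
      have h5 : b * (SymMat.grad F Z * (one : SymMat n).1).trace ≤ b * K₁ := by gcongr
      have h6 : a * (κ / 2 * ‖ζ‖ ^ 2) ≤ b * K₁ := by linarith
      have h7 : a * ‖ζ‖ ^ 2 = 2 / κ * (a * (κ / 2 * ‖ζ‖ ^ 2)) := by field_simp
      rw [h7]
      calc 2 / κ * (a * (κ / 2 * ‖ζ‖ ^ 2)) ≤ 2 / κ * (b * K₁) := by gcongr
        _ = _ := by ring
  · rintro _ ⟨M, hM, hFM, rfl⟩ R hsymm hinv
    set T := Matrix.toEuclideanCLM (n := Fin n) (𝕜 := ℝ) with hT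
    obtain ⟨Q, rfl⟩ := EquivLike.surjective T R
    have hstar : star Q = Q := by
      apply EquivLike.injective T
      rw [map_star, ContinuousLinearMap.star_eq_adjoint]
      exact ((ContinuousLinearMap.eq_adjoint_iff _ _).2 hsymm).symm
    have hQQ : Q * Q = 1 := by
      apply EquivLike.injective T
      rw [map_mul, map_one]
      ext1 v
      exact hinv v
    set O : Matrix.orthogonalGroup (Fin n) ℝ :=
      ⟨Q, Matrix.mem_unitaryGroup_iff'.2 (by rw [hstar, hQQ])⟩ with hO
    have hconjU : SymMat.conj O M ∈ U := by
      rw [← hUO O]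
      exact Set.mem_image_of_mem _ hM
    refine ⟨SymMat.conj O M, hconjU, (hFO O M hM).trans hFM, ?_⟩
    have e : (SymMat.conj O M).1 = star Q * M.1 * Q := rfl
    rw [e, hstar, map_mul, map_mul]
    rfl

/-- A symmetric matrix with nonnegative trace which is bounded from above is small. -/
theorem hsNorm_le {M : SymMat n} {τ : ℝ} (hτ : 0 ≤ τ) (htr : 0 ≤ M.1.trace)
    (h : ∀ v : EuclideanSpace ℝ (Fin n),
      ⟪Matrix.toEuclideanCLM (𝕜 := ℝ) M.1 v, v⟫ ≤ τ * ‖v‖ ^ 2) :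
    SymMat.hsNorm M ≤ n * (n + 1) * τ := by
  set P : SymMat n := τ • one - M with hP
  have hPe : ∀ i j, P.1 i j = τ * (1 : Matrix (Fin n) (Fin n) ℝ) i j - M.1 i j := fun i j => rfl
  have hPsd : P.1.PosSemidef := by
    apply posSemidef_of_inner_nonneg
    intro v
    change 0 ≤ ⟪Matrix.toEuclideanCLM (𝕜 := ℝ) (τ • (1 : Matrix (Fin n) (Fin n) ℝ) - M.1) v, v⟫
    rw [map_sub, map_smul, map_one, sub_apply, smul_apply, inner_sub_left, inner_smul_left,
      conj_trivial, one_apply_eq_self, real_inner_self_eq_norm_sq]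
    linarith [h v]
  have hdiag : ∀ i, P.1 i i ≤ n * τ := by
    intro i
    calc P.1 i i ≤ ∑ k, P.1 k k :=
          Finset.single_le_sum (f := fun k => P.1 k k) (fun k _ => hPsd.diag_nonneg)
            (Finset.mem_univ i)
      _ = n * τ - M.1.trace := by
        simp [hPe, Matrix.trace, Finset.sum_sub_distrib]
      _ ≤ n * τ := by linarith
  -- Testing P ≥ 0 on eᵢ ± eⱼ bounds an entry by the mean of two diagonal entries, each at most tr P
  -- ≤ nτ.
  have hentry : ∀ i j, |P.1 i j| ≤ n * τ := by
    intro i j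
    have hs : P.1 j i = P.1 i j := Matrix.IsSymm.apply P.2 i j
    have h1 := hPsd.dotProduct_mulVec_nonneg (Pi.single i 1 + Pi.single j 1)
    have h2 := hPsd.dotProduct_mulVec_nonneg (Pi.single i 1 - Pi.single j 1)
    simp only [star_trivial, Matrix.mulVec_add, Matrix.mulVec_sub, Matrix.mulVec_single_one,
      add_dotProduct, dotProduct_add, sub_dotProduct, dotProduct_sub, single_one_dotProduct,
      Matrix.col_apply, hs] at h1 h2
    rw [abs_le]
    constructor <;> linarith [hdiag i, hdiag j]
  have hM : ∀ i j, M.1 i j ^ 2 ≤ ((n + 1) * τ) ^ 2 := by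
    intro i j
    apply sq_le_sq'
    all_goals
      have h1 := abs_le.1 (hentry i j)
      rw [hPe] at h1
      have h2 : (1 : Matrix (Fin n) (Fin n) ℝ) i j = 0 ∨ (1 : Matrix (Fin n) (Fin n) ℝ) i j = 1 := by
        rw [Matrix.one_apply]; split_ifs <;> simp
      rcases h2 with h2 | h2 <;> rw [h2] at h1 <;> linarith
  rw [SymMat.hsNorm]
  apply Real.sqrt_le_iff.2 ⟨by positivity, ?_⟩
  calc ∑ i, ∑ j, M.1 i j ^ 2 ≤ ∑ _i : Fin n, ∑ _j : Fin n, ((n + 1) * τ) ^ 2 :=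
        Finset.sum_le_sum fun i _ => Finset.sum_le_sum fun j _ => hM i j
    _ = (n * (n + 1) * τ) ^ 2 := by simp; ring

end SymMat

end Matrices

/-! ### The substitution ξ = u^(-2/(n-2)). -/

section Substitution

variable {n : ℕ}

theorem EuclideanSpace.ext_inner_single {A B : EuclideanSpace ℝ (Fin n) →L[ℝ] EuclideanSpace ℝ (Fin n)}
    (h : ∀ i j, ⟪A (EuclideanSpace.single j 1), EuclideanSpace.single i (1 : ℝ)⟫ =
      ⟪B (EuclideanSpace.single j 1), EuclideanSpace.single i (1 : ℝ)⟫) : A = B := by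
  apply ContinuousLinearMap.coe_injective
  apply (EuclideanSpace.basisFun (Fin n) ℝ).toBasis.ext
  intro j
  ext i
  have := h i j
  rw [real_inner_comm, EuclideanSpace.inner_single_left, real_inner_comm,
    EuclideanSpace.inner_single_left] at this
  simpa using this

theorem inner_toEuclideanCLM_single (M : Matrix (Fin n) (Fin n) ℝ) (i j : Fin n) :
    ⟪Matrix.toEuclideanCLM (𝕜 := ℝ) M (EuclideanSpace.single j 1), EuclideanSpace.single i (1 : ℝ)⟫ =
      M i j := by
  rw [real_inner_comm, Matrix.inner_toEuclideanCLM]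
  simp

/-- The gradient of `u`. -/
noncomputable def gradField (u : EuclideanSpace ℝ (Fin n) → ℝ) (x : EuclideanSpace ℝ (Fin n)) :
    EuclideanSpace ℝ (Fin n) :=
  (InnerProductSpace.toDual ℝ (EuclideanSpace ℝ (Fin n))).symm (fderiv ℝ u x)

theorem inner_gradField (u : EuclideanSpace ℝ (Fin n) → ℝ) (x v : EuclideanSpace ℝ (Fin n)) :
    ⟪gradField u x, v⟫ = fderiv ℝ u x v := by
  rw [gradField, InnerProductSpace.toDual_symm_apply]

theorem norm_gradField_sq (u : EuclideanSpace ℝ (Fin n) → ℝ) (x : EuclideanSpace ℝ (Fin n)) :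
    ‖gradField u x‖ ^ 2 = ∑ k, partialD u x k ^ 2 := by
  rw [EuclideanSpace.real_norm_sq_eq]
  refine Finset.sum_congr rfl fun k _ => ?_
  rw [partialD, ← inner_gradField, real_inner_comm, EuclideanSpace.inner_single_left]
  simp

theorem contDiffOn_gradField {u : EuclideanSpace ℝ (Fin n) → ℝ} {O : Set (EuclideanSpace ℝ (Fin n))}
    (hO : IsOpen O) (hu : ContDiffOn ℝ 2 u O) : ContDiffOn ℝ 1 (gradField u) O := by
  have h1 : ContDiffOn ℝ 1 (fderiv ℝ u) O := hu.fderiv_of_isOpen hO (by norm_num)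
  exact (InnerProductSpace.toDual ℝ (EuclideanSpace ℝ (Fin n))).symm.toContinuousLinearEquiv.contDiff.comp_contDiffOn h1

theorem inner_fderiv_gradField {u : EuclideanSpace ℝ (Fin n) → ℝ}
    {O : Set (EuclideanSpace ℝ (Fin n))} (hO : IsOpen O) (hu : ContDiffOn ℝ 2 u O)
    {x : EuclideanSpace ℝ (Fin n)} (hx : x ∈ O) (i j : Fin n) :
    ⟪fderiv ℝ (gradField u) x (EuclideanSpace.single i 1), EuclideanSpace.single j (1 : ℝ)⟫ =
      partialD2 u x i j := by
  have h1 : ContDiffOn ℝ 1 (fderiv ℝ u) O := hu.fderiv_of_isOpen hO (by norm_num)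
  have h2 : HasFDerivAt (fderiv ℝ u) (fderiv ℝ (fderiv ℝ u) x) x :=
    ((h1.differentiableOn one_ne_zero).differentiableAt (hO.mem_nhds hx)).hasFDerivAt
  have h3 : HasFDerivAt (gradField u) _ x :=
    ((InnerProductSpace.toDual ℝ
      (EuclideanSpace ℝ (Fin n))).symm.toContinuousLinearEquiv.hasFDerivAt).comp x h2
  rw [h3.fderiv, partialD2, iteratedFDeriv_two_apply]
  exact InnerProductSpace.toDual_symm_apply

/-- The substitution `ξ = u ^ s`. -/
theorem isConformalSolution_rpow {u : EuclideanSpace ℝ (Fin n) → ℝ}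
    {O : Set (EuclideanSpace ℝ (Fin n))} (hO : IsOpen O) (hu : ContDiffOn ℝ 2 u O)
    (hpos : ∀ x ∈ O, 0 < u x) (s : ℝ)
    {𝓛 : Set (EuclideanSpace ℝ (Fin n) →L[ℝ] EuclideanSpace ℝ (Fin n))}
    (hmem : ∀ x ∈ O, jetHessian (u x ^ s) ((s * u x ^ (s - 1)) • gradField u x)
      ((s * u x ^ (s - 1)) • fderiv ℝ (gradField u) x + (s * (s - 1) * u x ^ (s - 2)) •
        (innerSL ℝ (gradField u x)).smulRight (gradField u x)) ∈ 𝓛) :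
    IsConformalSolution 𝓛 O (fun x => u x ^ s) (fun x => (s * u x ^ (s - 1)) • gradField u x)
      (fun x => (s * u x ^ (s - 1)) • fderiv ℝ (gradField u) x + (s * (s - 1) * u x ^ (s - 2)) •
        (innerSL ℝ (gradField u x)).smulRight (gradField u x)) := by
  have hg := contDiffOn_gradField hO hu
  have hgd : ∀ x ∈ O, HasFDerivAt (gradField u) (fderiv ℝ (gradField u) x) x := fun x hx =>
    ((hg.differentiableOn one_ne_zero).differentiableAt (hO.mem_nhds hx)).hasFDerivAt
  have hud : ∀ x ∈ O, HasFDerivAt u (innerSL ℝ (gradField u x)) x := by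
    intro x hx
    refine ((hu.differentiableOn two_ne_zero).differentiableAt
      (hO.mem_nhds hx)).hasFDerivAt.congr_fderiv ?_
    ext v
    rw [innerSL_apply_apply, inner_gradField]
  refine ⟨fun x hx => Real.rpow_pos_of_pos (hpos x hx) s, fun x hx => ?_, fun x hx => ?_,
    fun x hx => ?_, hmem⟩
  · refine ((hud x hx).rpow_const (Or.inl (hpos x hx).ne')).congr_fderiv ?_
    rw [map_smul]
  · have h1 := (((hud x hx).rpow_const (p := s - 1) (Or.inl (hpos x hx).ne')).const_mul s).smul
      (hgd x hx)
    refine h1.congr_fderiv ?_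
    ext1 v
    simp only [add_apply, smul_apply, ContinuousLinearMap.smulRight_apply, smul_eq_mul, smul_smul]
    rw [show s - 1 - 1 = s - 2 by ring]
    congr 2
    ring
  · have h1 := (hud x hx).continuousAt
    have h2 := (hgd x hx).continuousAt
    have h3 : ContinuousAt (fderiv ℝ (gradField u)) x :=
      (hg.continuousOn_fderiv_of_isOpen hO le_rfl).continuousAt (hO.mem_nhds hx)
    have h4 : ContinuousAt
        (fun x => (innerSL ℝ (gradField u x)).smulRight (gradField u x)) x :=
      (((ContinuousLinearMap.smulRightL ℝ (EuclideanSpace ℝ (Fin n))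
        (EuclideanSpace ℝ (Fin n))).continuous.comp
          (innerSL ℝ).continuous).continuousAt.comp h2).clm_apply h2
    exact ((continuousAt_const.mul (h1.rpow_const (Or.inl (hpos x hx).ne'))).smul h3).add
      ((continuousAt_const.mul (h1.rpow_const (Or.inl (hpos x hx).ne'))).smul h4)

/-- The conformal Hessian of `u` in terms of `ξ = u ^ (-2 / (n - 2))`. -/
theorem jetHessian_rpow_eq (hn : 3 ≤ n) {u : EuclideanSpace ℝ (Fin n) → ℝ}
    {O : Set (EuclideanSpace ℝ (Fin n))} (hO : IsOpen O) (hu : ContDiffOn ℝ 2 u O)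
    {x : EuclideanSpace ℝ (Fin n)} (hx : x ∈ O) (hpos : 0 < u x) {s : ℝ}
    (hs : s = -(2 / ((n : ℝ) - 2))) (hsymm : (conformalHessian u x).IsSymm) :
    jetHessian (u x ^ s) ((s * u x ^ (s - 1)) • gradField u x)
      ((s * u x ^ (s - 1)) • fderiv ℝ (gradField u) x + (s * (s - 1) * u x ^ (s - 2)) •
        (innerSL ℝ (gradField u x)).smulRight (gradField u x)) =
      Matrix.toEuclideanCLM (𝕜 := ℝ) (conformalHessian u x) := by
  have hn' : (n : ℝ) - 2 ≠ 0 := by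
    have : (3 : ℝ) ≤ n := by exact_mod_cast hn
    linarith
  apply EuclideanSpace.ext_inner_single
  intro i j
  rw [inner_toEuclideanCLM_single, ← hsymm.apply]
  simp only [jetHessian, conformalHessian, Matrix.add_apply, Matrix.sub_apply, Matrix.smul_apply,
    Matrix.of_apply, smul_eq_mul, add_apply, sub_apply, smul_apply, inner_add_left, inner_sub_left,
    inner_smul_left, conj_trivial, ContinuousLinearMap.smulRight_apply, innerSL_apply_apply,
    inner_gradField, inner_fderiv_gradField hO hu hx, ContinuousLinearMap.id_apply, norm_smul,
    mul_pow, norm_gradField_sq, Real.norm_eq_abs, sq_abs]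
  have e0 : ⟪EuclideanSpace.single j (1 : ℝ), EuclideanSpace.single i (1 : ℝ)⟫ =
      (1 : Matrix (Fin n) (Fin n) ℝ) j i := by
    rw [EuclideanSpace.inner_single_left, Matrix.one_apply]
    simp
  have e1 : u x ^ (-(((n : ℝ) + 2) / ((n : ℝ) - 2))) = u x ^ s * u x ^ (s - 1) := by
    rw [← Real.rpow_add hpos]
    congr 1
    rw [hs]
    field_simp
    ring
  have e2 : u x ^ (-(2 * (n : ℝ) / ((n : ℝ) - 2))) = u x ^ s * u x ^ (s - 2) := by
    rw [← Real.rpow_add hpos]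
    congr 1
    rw [hs]
    field_simp
    ring
  have e3 : (u x ^ (s - 1)) ^ 2 = u x ^ s * u x ^ (s - 2) := by
    rw [← Real.rpow_add hpos, ← Real.rpow_natCast, ← Real.rpow_mul hpos.le]
    congr 1
    push_cast
    ring
  have c1 : 2 * (n : ℝ) / ((n : ℝ) - 2) ^ 2 = s * (s - 1) := by
    rw [hs]; field_simp; ring
  have c2 : 2 / ((n : ℝ) - 2) ^ 2 = s ^ 2 / 2 := by
    rw [hs]; field_simp
  have p1 : ∀ k, fderiv ℝ u x (EuclideanSpace.single k 1) = partialD u x k := fun k => rfl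
  rw [e0, e1, e2, e3, c1, c2, ← hs, p1, p1]
  ring

/-- The two gradient terms cancel, since the identity has trace n; the sign of the trace is thus
decided by superharmonicity. -/
theorem trace_conformalHessian (hn : 3 ≤ n) (u : EuclideanSpace ℝ (Fin n) → ℝ)
    (x : EuclideanSpace ℝ (Fin n)) :
    (conformalHessian u x).trace =
      -(2 / ((n : ℝ) - 2) * u x ^ (-(((n : ℝ) + 2) / ((n : ℝ) - 2))) *
        Laplacian.laplacian u x) := by
  have hn' : (n : ℝ) - 2 ≠ 0 := by
    have : (3 : ℝ) ≤ n := by exact_mod_cast hn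
    linarith
  have hl : Laplacian.laplacian u x = ∑ i, partialD2 u x i i := by
    rw [InnerProductSpace.laplacian_eq_iteratedFDeriv_orthonormalBasis u
      (EuclideanSpace.basisFun (Fin n) ℝ)]
    simp [partialD2]
  have h1 : (Matrix.of fun i j => partialD2 u x i j).trace = ∑ i, partialD2 u x i i := rfl
  have h2 : (Matrix.of fun i j => partialD u x i * partialD u x j).trace =
      ∑ k, partialD u x k ^ 2 := by
    simp [Matrix.trace, sq]
  rw [conformalHessian, Matrix.trace_sub, Matrix.trace_add, Matrix.trace_smul, Matrix.trace_smul,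
    Matrix.trace_smul, Matrix.trace_one, h1, h2, hl]
  simp only [smul_eq_mul, Fintype.card_fin]
  field_simp
  ring

end Substitution

/-! ### Conclusion. -/

theorem theorem2 (n : ℕ) (hn : 3 ≤ n) :
    ∃ C : ℝ, 0 < C ∧
      ∀ (U : Set (SymMat n)) (F : SymMat n → ℝ) (δ R : ℝ) (u : EuclideanSpace ℝ (Fin n) → ℝ),
        IsOpen U →
        (∀ O : Matrix.orthogonalGroup (Fin n) ℝ, SymMat.conj O '' U = U) →
        (∀ M N : SymMat n, N.1.PosDef →
          Convex ℝ (U ∩ {X : SymMat n | ∃ t : ℝ, 0 < t ∧ X = M + t • N})) →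
        ContDiffOn ℝ 1 F U →
        (∀ O : Matrix.orthogonalGroup (Fin n) ℝ, ∀ M ∈ U, F (SymMat.conj O M) = F M) →
        (∀ M ∈ U, (SymMat.grad F M).PosDef) →
        0 < δ →
        (∀ M ∈ U, SymMat.hsNorm M < δ → F M ≠ 1) →
        0 < R →
        ContDiffOn ℝ 2 u (Metric.ball 0 (3 * R)) →
        (∀ x ∈ Metric.ball (0 : EuclideanSpace ℝ (Fin n)) (3 * R), 0 < u x) →
        (∀ x ∈ Metric.ball (0 : EuclideanSpace ℝ (Fin n)) (3 * R), Laplacian.laplacian u x ≤ 0) →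
        (∀ x ∈ Metric.ball (0 : EuclideanSpace ℝ (Fin n)) (3 * R),
          ∃ M ∈ U, (M : Matrix (Fin n) (Fin n) ℝ) = conformalHessian u x ∧ F M = 1) →
        sSup (u '' Metric.ball 0 R) * sInf (u '' Metric.ball 0 (2 * R)) ≤
          C * δ ^ ((2 - (n : ℝ)) / 2) * R ^ (2 - (n : ℝ)) := by
  have hn3 : (3 : ℝ) ≤ n := by exact_mod_cast hn
  have hn2 : 0 < (n : ℝ) - 2 := by linarith
  set K : ℝ := n * (n + 1) * 1152 with hK
  have hK0 : 0 < K := by positivity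
  refine ⟨K ^ (-((2 - (n : ℝ)) / 2)), Real.rpow_pos_of_pos hK0 _, ?_⟩
  intro U F δ R u hU hUO hconv hF hFO hell hδ hFδ hR hu hpos hlap hsol
  set s : ℝ := -(2 / ((n : ℝ) - 2)) with hs
  set e : ℝ := (2 - (n : ℝ)) / 2 with he
  have hse : s * e = 1 := by rw [hs, he]; field_simp; ring
  have he0 : e ≤ 0 := by rw [he]; linarith
  have hs0 : s ≤ 0 := by rw [hs]; have : 0 < 2 / ((n : ℝ) - 2) := by positivity
                         linarith
  have h𝓛 := SymMat.ellipticLevelSet hU hUO hconv hF hFO hell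
  have hjet : ∀ x ∈ ball (0 : EuclideanSpace ℝ (Fin n)) (3 * R), _ := fun x hx =>
    jetHessian_rpow_eq hn isOpen_ball hu hx (hpos x hx) hs (by
      obtain ⟨M, -, hM, -⟩ := hsol x hx
      rw [← hM]
      exact M.2)
  have hξ := isConformalSolution_rpow isOpen_ball hu hpos s (𝓛 := SymMat.levelSet U F) (by
    intro x hx
    rw [hjet x hx]
    obtain ⟨M, hMU, hM, hFM⟩ := hsol x hx
    exact ⟨M, hMU, hFM, by rw [hM]⟩)
  have hR2 : R ^ (2 - (n : ℝ)) = (R ^ 2) ^ e := by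
    rw [← Real.rpow_natCast, ← Real.rpow_mul hR.le, he]
    congr 1
    push_cast
    ring
  set b := sInf (u '' ball 0 (2 * R)) with hb
  have hsub2 : ball (0 : EuclideanSpace ℝ (Fin n)) (2 * R) ⊆ ball 0 (3 * R) :=
    ball_subset_ball (by linarith)
  have hb0 : 0 ≤ b := by
    apply Real.sInf_nonneg
    rintro _ ⟨x, hx, rfl⟩
    exact (hpos x (hsub2 hx)).le
  -- If the infimum is 0, the left side vanishes whatever value `sSup` takes, including its default
  -- on an unbounded set.
  rcases hb0.eq_or_lt with hb0 | hbpos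
  · rw [← hb0, mul_zero]
    positivity
  have hbu : ∀ x ∈ ball (0 : EuclideanSpace ℝ (Fin n)) (2 * R), b ≤ u x := by
    intro x hx
    refine csInf_le ⟨0, ?_⟩ (Set.mem_image_of_mem u hx)
    rintro _ ⟨y, hy, rfl⟩
    exact (hpos y (hsub2 hy)).le
  rw [← le_div_iff₀ hbpos]
  refine csSup_le ((nonempty_ball.2 hR).image u) ?_
  rintro _ ⟨x₀, hx₀, rfl⟩
  rw [le_div_iff₀ hbpos]
  have hux₀ : 0 < u x₀ := hpos x₀ (ball_subset_ball (by linarith) hx₀)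
  obtain ⟨z, hz, hzle⟩ := hξ.exists_jetHessian_le h𝓛 hR (S := b ^ s)
    (fun x hx => Real.rpow_le_rpow_of_nonpos hbpos (hbu x hx) hs0) hx₀
  obtain ⟨M, hMU, hM, hFM⟩ := hsol z hz
  simp only at hzle
  rw [hjet z hz, ← hM] at hzle
  have htr : 0 ≤ M.1.trace := by
    rw [hM, trace_conformalHessian hn]
    have h1 := hlap z hz
    have h2 := Real.rpow_pos_of_pos (hpos z hz) (-(((n : ℝ) + 2) / ((n : ℝ) - 2)))
    have h3 : 0 < 2 / ((n : ℝ) - 2) * u z ^ (-(((n : ℝ) + 2) / ((n : ℝ) - 2))) := by positivity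
    nlinarith
  have hub : 0 < u x₀ * b := by positivity
  have hδle : δ ≤ K * (u x₀ * b) ^ s / R ^ 2 := by
    by_contra! hcon
    refine hFδ M hMU (lt_of_le_of_lt (SymMat.hsNorm_le ?_ htr hzle) ?_) hFM
    · positivity
    · rw [Real.mul_rpow hux₀.le hbpos.le] at hcon
      calc _ = K * (u x₀ ^ s * b ^ s) / R ^ 2 := by rw [hK]; ring
        _ < δ := hcon
  have h1 : δ * R ^ 2 ≤ K * (u x₀ * b) ^ s := by
    rwa [le_div_iff₀ (by positivity)] at hδle
  -- Raising to the power e ≤ 0 reverses the inequality, and se = 1 recovers u(x₀)·b; the factor K^e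
  -- becomes the constant K^(-e).
  have h2 := Real.rpow_le_rpow_of_nonpos (by positivity) h1 he0
  rw [Real.mul_rpow hδ.le (by positivity), Real.mul_rpow hK0.le (by positivity),
    ← Real.rpow_mul hub.le, hse, Real.rpow_one] at h2
  rw [hR2, Real.rpow_neg hK0.le]
  have h3 : 0 < K ^ e := Real.rpow_pos_of_pos hK0 e
  rw [mul_assoc, ← div_eq_inv_mul, le_div_iff₀ h3]
  linarith
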